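/- Let $\mathfrak g$ be a finite-dimensional simple Lie algebra over $\mathbf C$ with a symmetric, invariant, nondegenerate bilinear form $(\cdot\mid\cdot)$, and let $f_1,f_2\in\mathfrak g$ be nilpotent. For $i=1,2$ let $\chi_i=(f_i\mid\cdot)\in\mathfrak g^*$ and let $\Gamma^i:\mathfrak g=\bigoplus_{j\in\mathbf Z}\mathfrak g^{(i)}_j$ be a good grading for $f_i$, that is, a Lie algebra grading with $f_i\in\mathfrak g^{(i)}_{-2}$ such that $\operatorname{ad}(f_i):\mathfrak g^{(i)}_j\to\mathfrak g^{(i)}_{j-2}$ is injective for $j\ge 1$ and surjective for $j\le 1$. Let $q_i\in\mathfrak g$ be the semisimple element with $\mathfrak g^{(i)}_j=\{x\in\mathfrak g : [q_i,x]=jx\}$ for all $j$, and assume that $q_1,q_2$ lie in a common Cartan subalgebra $\mathfrak h$. Let $\mathfrak m_i=\mathfrak l_i\oplus\bigoplus_{j\ge 2}\mathfrak g^{(i)}_j$, where $\mathfrak l_i$ is a Lagrangian subspace of $\mathfrak g^{(i)}_1$ for the symplectic form $\chi_i([\cdot,\cdot])$; this is a Lie subalgebra of which $\chi_i$ is a character.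 Let $\widehat{I_i}$ be the left ideal of $\mathcal U(\mathfrak g)$ generated by the elements $y-\chi_i(y)$, $y\in\mathfrak m_i$. The finite W-algebra of $f_i$ is $$\mathcal U(\mathfrak g,f_i)=\bigl(\mathcal U(\mathfrak g)/\widehat{I_i}\bigr)^{\operatorname{ad}(\mathfrak m_i)}=\{X \bmod \widehat{I_i} : [y,X]\in\widehat{I_i}\ \text{for all } y\in\mathfrak m_i\},$$ with the product induced by that of $\mathcal U(\mathfrak g)$. Assume that: 1. $\mathfrak m_2=\mathfrak m_1\oplus\mathfrak m_0$ as vector spaces, where $\mathfrak m_0$ is an $\mathfrak h$-stable Lie subalgebra of $\mathfrak m_2$ and $\mathfrak m_1$ is an ideal of $\mathfrak m_2$; 2. $f_0:=f_2-f_1$ and $\mathfrak m_0$ are contained in $\mathfrak g^{(1)}_0$; 3. $q_0:=q_2-q_1$ commutes with $f_1$. Then the map $\mathfrak m_0\to\mathcal U(\mathfrak g,f_1)$, $y\mapsto y\bmod\widehat{I_1}$, is a well-defined injective homomorphism of Lie algebras. Let $\widehat{I_0}$ be the left ideal of $\mathcal U(\mathfrak g,f_1)$ generated by the elements $(y-\chi_2(y))\bmod\widehat{I_1}$,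 $y\in\mathfrak m_0$, and let $$\mathcal U_0=\bigl(\mathcal U(\mathfrak g,f_1)/\widehat{I_0}\bigr)^{\operatorname{ad}(\mathfrak m_0)},$$ with the product induced by that of $\mathcal U(\mathfrak g,f_1)$; this is the quantum Hamiltonian reduction of $\mathcal U(\mathfrak g,f_1)$ by $\mathfrak m_0$. Then the map $$\widehat\Psi:\mathcal U_0\longrightarrow\mathcal U(\mathfrak g,f_2),\qquad (X\bmod\widehat{I_1})\bmod\widehat{I_0}\longmapsto X\bmod\widehat{I_2},$$ is a well-defined isomorphism of $\mathbf C$-algebras. -/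

import Mathlib

attribute [local instance 100] LieRing.ofAssociativeRing

noncomputable section

/-! ### Quantum Hamiltonian reduction

Data: an associative unital `ℂ`-algebra `A`, a Lie algebra `𝔪`, a Lie algebra homomorphism
`φ : 𝔪 → A` (for the commutator bracket of `A`) and a linear form `χ` on `𝔪`. -/

namespace QuantumReduction

variable {A : Type*} [Ring A] [Algebra ℂ A] {𝔪 : Type*} [LieRing 𝔪] [LieAlgebra ℂ 𝔪]
  (φ : 𝔪 →ₗ⁅ℂ⁆ A) (χ : 𝔪 →ₗ[ℂ] ℂ)

/-- The left ideal of `A` generated by the elements `φ y - χ y`, `y ∈ 𝔪`. -/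
def leftIdeal : Ideal A :=
  Ideal.span (Set.range fun y : 𝔪 => φ y - algebraMap ℂ A (χ y))

/-- The left `A`-module `Q = A / leftIdeal`. -/
abbrev Q : Type _ := A ⧸ leftIdeal φ χ

/-- The class `X mod leftIdeal` in `Q`. -/
abbrev toQ (X : A) : Q φ χ := Submodule.Quotient.mk X

variable {φ χ}

theorem gen_mem (y : 𝔪) : φ y - algebraMap ℂ A (χ y) ∈ leftIdeal φ χ :=
  Ideal.subset_span ⟨y, rfl⟩

/-- Modulo the left ideal, `[φ y, X]` equals `(φ y - χ y) X`. -/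
theorem lie_mem_iff (y : 𝔪) (X : A) :
    ⁅φ y, X⁆ ∈ leftIdeal φ χ ↔ (φ y - algebraMap ℂ A (χ y)) * X ∈ leftIdeal φ χ := by
  have h : (φ y - algebraMap ℂ A (χ y)) * X
      = ⁅φ y, X⁆ + X * (φ y - algebraMap ℂ A (χ y)) := by
    rw [LieRing.of_associative_ring_bracket, sub_mul, mul_sub, Algebra.commutes (χ y) X]
    abel
  rw [h]
  exact (Submodule.add_mem_iff_left _
    (Submodule.smul_mem (leftIdeal φ χ) X (gen_mem y))).symm

variable (φ χ)

/-- The subspace `Q^{ad 𝔪}`: all classes `X mod leftIdeal` such that `[φ y, X]` lies in the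
left ideal for all `y ∈ 𝔪`. -/
def invariants : Submodule ℂ (Q φ χ) where
  carrier := {q | ∃ X : A, toQ φ χ X = q ∧ ∀ y : 𝔪, ⁅φ y, X⁆ ∈ leftIdeal φ χ}
  zero_mem' := ⟨0, rfl, fun y => by simp⟩
  add_mem' := by
    rintro _ _ ⟨X, rfl, hX⟩ ⟨Y, rfl, hY⟩
    exact ⟨X + Y, rfl, fun y => by rw [lie_add]; exact add_mem (hX y) (hY y)⟩
  smul_mem' := by
    rintro c _ ⟨X, rfl, hX⟩
    refine ⟨c • X, rfl, fun y => ?_⟩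
    rw [lie_smul, ← algebraMap_smul A c]
    exact Submodule.smul_mem _ _ (hX y)

variable {φ χ}

/-- The invariance condition does not depend on the representative. -/
theorem toQ_mem_invariants_iff (X : A) :
    toQ φ χ X ∈ invariants φ χ ↔ ∀ y : 𝔪, ⁅φ y, X⁆ ∈ leftIdeal φ χ := by
  refine ⟨?_, fun h => ⟨X, rfl, h⟩⟩
  rintro ⟨Y, hYX, hY⟩ y
  have hd : Y - X ∈ leftIdeal φ χ := (Submodule.Quotient.eq _).1 hYX
  rw [lie_mem_iff]
  have h1 := (lie_mem_iff y Y).1 (hY y)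
  have h2 := Submodule.smul_mem (leftIdeal φ χ) (φ y - algebraMap ℂ A (χ y)) hd
  rw [smul_eq_mul, mul_sub] at h2
  exact (Submodule.sub_mem_iff_right _ h1).1 h2

/-- For an invariant class `b`, the map `X mod leftIdeal ↦ X • b` of `Q` to itself. -/
def rightMul (b : invariants φ χ) : Q φ χ →ₗ[A] Q φ χ :=
  Submodule.liftQ (leftIdeal φ χ) (LinearMap.toSpanSingleton A (Q φ χ) (b : Q φ χ)) (by
    obtain ⟨_, Y, rfl, hY⟩ := b
    refine Submodule.span_le.2 ?_
    rintro _ ⟨y, rfl⟩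
    exact (Submodule.Quotient.mk_eq_zero _).2 ((lie_mem_iff y Y).1 (hY y)))

theorem rightMul_toQ (X Y : A) (hY : toQ φ χ Y ∈ invariants φ χ) :
    rightMul ⟨toQ φ χ Y, hY⟩ (toQ φ χ X) = toQ φ χ (X * Y) := rfl

theorem toQ_mul_mem {X Y : A} (hX : toQ φ χ X ∈ invariants φ χ)
    (hY : toQ φ χ Y ∈ invariants φ χ) : toQ φ χ (X * Y) ∈ invariants φ χ := by
  rw [toQ_mem_invariants_iff] at *
  intro y
  have h1 : ⁅φ y, X⁆ * Y ∈ leftIdeal φ χ := by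
    have h := rightMul_toQ ⁅φ y, X⁆ Y ((toQ_mem_invariants_iff Y).2 hY)
    have h0 : toQ φ χ ⁅φ y, X⁆ = 0 := (Submodule.Quotient.mk_eq_zero _).2 (hX y)
    rw [h0, map_zero] at h
    exact (Submodule.Quotient.mk_eq_zero _).1 h.symm
  have h2 : ⁅φ y, X * Y⁆ = ⁅φ y, X⁆ * Y + X * ⁅φ y, Y⁆ := by
    simp only [LieRing.of_associative_ring_bracket]
    noncomm_ring
  rw [h2]
  exact add_mem h1 (Submodule.smul_mem (leftIdeal φ χ) X (hY y))

instance : Mul (invariants φ χ) where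
  mul a b := ⟨rightMul b a, by
    obtain ⟨_, X, rfl, hX⟩ := a
    obtain ⟨_, Y, rfl, hY⟩ := b
    exact toQ_mul_mem ⟨X, rfl, hX⟩ ⟨Y, rfl, hY⟩⟩

instance : One (invariants φ χ) where
  one := ⟨toQ φ χ 1, 1, rfl, fun y => by simp [LieRing.of_associative_ring_bracket]⟩

/-- The product of `Q^{ad 𝔪}` is induced by that of `A`. -/
theorem mk_mul_mk {X Y : A} (hX : toQ φ χ X ∈ invariants φ χ)
    (hY : toQ φ χ Y ∈ invariants φ χ) :
    (⟨toQ φ χ X, hX⟩ * ⟨toQ φ χ Y, hY⟩ : invariants φ χ)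
      = ⟨toQ φ χ (X * Y), toQ_mul_mem hX hY⟩ := rfl

theorem one_def : (1 : invariants φ χ) = ⟨toQ φ χ 1, (1 : invariants φ χ).2⟩ := rfl

theorem exists_rep (a : invariants φ χ) :
    ∃ (X : A) (hX : toQ φ χ X ∈ invariants φ χ), a = ⟨toQ φ χ X, hX⟩ := by
  obtain ⟨_, X, rfl, hX⟩ := a
  exact ⟨X, _, rfl⟩

instance : Ring (invariants φ χ) where
  __ := (inferInstance : AddCommGroup (invariants φ χ))
  __ := (inferInstance : Mul (invariants φ χ))
  __ := (inferInstance : One (invariants φ χ))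
  left_distrib a b c := by
    obtain ⟨X, hX, rfl⟩ := exists_rep a
    obtain ⟨Y, hY, rfl⟩ := exists_rep b
    obtain ⟨Z, hZ, rfl⟩ := exists_rep c
    exact Subtype.ext (congrArg (toQ φ χ) (mul_add X Y Z))
  right_distrib a b c := by
    obtain ⟨X, hX, rfl⟩ := exists_rep a
    obtain ⟨Y, hY, rfl⟩ := exists_rep b
    obtain ⟨Z, hZ, rfl⟩ := exists_rep c
    exact Subtype.ext (congrArg (toQ φ χ) (add_mul X Y Z))
  zero_mul a := by
    obtain ⟨X, hX, rfl⟩ := exists_rep a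
    exact Subtype.ext (congrArg (toQ φ χ) (zero_mul X))
  mul_zero a := by
    obtain ⟨X, hX, rfl⟩ := exists_rep a
    exact Subtype.ext (congrArg (toQ φ χ) (mul_zero X))
  mul_assoc a b c := by
    obtain ⟨X, hX, rfl⟩ := exists_rep a
    obtain ⟨Y, hY, rfl⟩ := exists_rep b
    obtain ⟨Z, hZ, rfl⟩ := exists_rep c
    exact Subtype.ext (congrArg (toQ φ χ) (mul_assoc X Y Z))
  one_mul a := by
    obtain ⟨X, hX, rfl⟩ := exists_rep a
    exact Subtype.ext (congrArg (toQ φ χ) (one_mul X))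
  mul_one a := by
    obtain ⟨X, hX, rfl⟩ := exists_rep a
    exact Subtype.ext (congrArg (toQ φ χ) (mul_one X))

instance : Algebra ℂ (invariants φ χ) :=
  Algebra.ofModule
    (fun c a b => by
      obtain ⟨X, hX, rfl⟩ := exists_rep a
      obtain ⟨Y, hY, rfl⟩ := exists_rep b
      exact Subtype.ext (congrArg (toQ φ χ) (smul_mul_assoc c X Y)))
    (fun c a b => by
      obtain ⟨X, hX, rfl⟩ := exists_rep a
      obtain ⟨Y, hY, rfl⟩ := exists_rep b
      exact Subtype.ext (congrArg (toQ φ χ) (mul_smul_comm c X Y)))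

end QuantumReduction

/-! ### Good gradings, good algebras and finite W-algebras -/

namespace FiniteW

variable {𝔤 : Type*} [LieRing 𝔤] [LieAlgebra ℂ 𝔤]

/-- `Γ` is a `ℤ`-grading of the Lie algebra `𝔤` that is good for `f`. -/
structure IsGoodGrading (Γ : ℤ → Submodule ℂ 𝔤) (f : 𝔤) : Prop where
  isInternal : DirectSum.IsInternal Γ
  lie_mem : ∀ i j : ℤ, ∀ x ∈ Γ i, ∀ y ∈ Γ j, ⁅x, y⁆ ∈ Γ (i + j)
  mem_neg_two : f ∈ Γ (-2)
  injective : ∀ j : ℤ, 1 ≤ j → ∀ x ∈ Γ j, ⁅f, x⁆ = 0 → x = 0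
  surjective : ∀ j : ℤ, j ≤ 1 → ∀ y ∈ Γ (j - 2), ∃ x ∈ Γ j, ⁅f, x⁆ = y

/-- `q` is the element of `𝔤` defining the grading `Γ`: the homogeneous component of degree `j`
is the eigenspace of `ad q` for the eigenvalue `j`. -/
def IsGradingElement (Γ : ℤ → Submodule ℂ 𝔤) (q : 𝔤) : Prop :=
  ∀ (j : ℤ) (x : 𝔤), x ∈ Γ j ↔ ⁅q, x⁆ = (j : ℂ) • x

/-- The linear form `χ = (f | ·)` on `𝔤`. -/
abbrev chi (B : LinearMap.BilinForm ℂ 𝔤) (f : 𝔤) : 𝔤 →ₗ[ℂ] ℂ := B f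

/-- `𝔩` is a Lagrangian subspace of the symplectic space `Γ 1` with the form `χ([·,·])`: it is
equal to its own orthogonal in `Γ 1`. -/
def IsLagrangian (B : LinearMap.BilinForm ℂ 𝔤) (Γ : ℤ → Submodule ℂ 𝔤) (f : 𝔤)
    (𝔩 : Submodule ℂ 𝔤) : Prop :=
  ∀ x : 𝔤, x ∈ 𝔩 ↔ x ∈ Γ 1 ∧ ∀ y ∈ 𝔩, chi B f ⁅x, y⁆ = 0

/-- `𝔪` is a good algebra for `Γ` and `f`: it is `𝔩 ⊕ ⨁_{i ≥ 2} Γ i` for some Lagrangian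
subspace `𝔩` of `Γ 1`. -/
def IsGoodAlgebra (B : LinearMap.BilinForm ℂ 𝔤) (Γ : ℤ → Submodule ℂ 𝔤) (f : 𝔤)
    (𝔪 : LieSubalgebra ℂ 𝔤) : Prop :=
  ∃ 𝔩 : Submodule ℂ 𝔤, IsLagrangian B Γ f 𝔩 ∧
    𝔪.toSubmodule = 𝔩 ⊔ ⨆ (i : ℤ) (_ : 2 ≤ i), Γ i

/-- The Lie algebra homomorphism `𝔪 → 𝔤 → U(𝔤)`. -/
abbrev toU (𝔪 : LieSubalgebra ℂ 𝔤) : 𝔪 →ₗ⁅ℂ⁆ UniversalEnvelopingAlgebra ℂ 𝔤 :=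
  (UniversalEnvelopingAlgebra.ι ℂ).comp 𝔪.incl

/-- The restriction of `χ = (f | ·)` to `𝔪`. -/
abbrev chiOn (B : LinearMap.BilinForm ℂ 𝔤) (f : 𝔤) (𝔪 : LieSubalgebra ℂ 𝔤) : 𝔪 →ₗ[ℂ] ℂ :=
  (chi B f).comp 𝔪.toSubmodule.subtype

/-- The generalized Gelfand-Graev module `U(𝔤) / Î`, where `Î` is the left ideal generated by
`y - χ(y)`, `y ∈ 𝔪`. -/
abbrev GelfandGraev (B : LinearMap.BilinForm ℂ 𝔤) (f : 𝔤) (𝔪 : LieSubalgebra ℂ 𝔤) : Type _ :=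
  QuantumReduction.Q (toU 𝔪) (chiOn B f 𝔪)

/-- The class `X mod Î`. -/
abbrev toGG (B : LinearMap.BilinForm ℂ 𝔤) (f : 𝔤) (𝔪 : LieSubalgebra ℂ 𝔤)
    (X : UniversalEnvelopingAlgebra ℂ 𝔤) : GelfandGraev B f 𝔪 :=
  QuantumReduction.toQ (toU 𝔪) (chiOn B f 𝔪) X

/-- The finite W-algebra `U(𝔤, f) = (U(𝔤) / Î)^{ad 𝔪}`. -/
abbrev WAlgebra (B : LinearMap.BilinForm ℂ 𝔤) (f : 𝔤) (𝔪 : LieSubalgebra ℂ 𝔤) :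
    Submodule ℂ (GelfandGraev B f 𝔪) :=
  QuantumReduction.invariants (toU 𝔪) (chiOn B f 𝔪)

end FiniteW

end

/-! ### Words in a family of elements of an algebra -/

namespace WordSpan

variable {K A κ : Type*} [Field K] [Ring A] [Algebra K A] (g : κ → A)

/-- The product of the elements `g i`, for `i` running through a list. -/
def word (l : List κ) : A := (l.map g).prod

@[simp] theorem word_nil : word g [] = 1 := rfl

@[simp] theorem word_cons (i : κ) (l : List κ) : word g (i :: l) = g i * word g l := by
  simp [word]

@[simp] theorem word_append (l l' : List κ) : word g (l ++ l') = word g l * word g l' := by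
  simp [word]

variable (K)

/-- The span of the words of length at least `n` and less than `m`. -/
def wordSpan (n m : ℕ) : Submodule K A :=
  Submodule.span K {a | ∃ l : List κ, n ≤ l.length ∧ l.length < m ∧ word g l = a}

variable {K g}

theorem word_mem_wordSpan {n m : ℕ} {l : List κ} (h : n ≤ l.length) (h' : l.length < m) :
    word g l ∈ wordSpan K g n m := Submodule.subset_span ⟨l, h, h', rfl⟩

theorem mul_word_mem {n m : ℕ} {a : A} (ha : a ∈ wordSpan K g n m) (l : List κ) :
    a * word g l ∈ wordSpan K g n (m + l.length) := by
  induction ha using Submodule.span_induction with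
  | mem x hx =>
    obtain ⟨w, h1, h2, rfl⟩ := hx
    rw [← word_append]
    exact word_mem_wordSpan (by simp; omega) (by simp; omega)
  | zero => simp
  | add x y _ _ hx hy => rw [add_mul]; exact add_mem hx hy
  | smul c x _ hx => rw [smul_mul_assoc]; exact Submodule.smul_mem _ _ hx

theorem cons_mul_mem {n m : ℕ} {a : A} (ha : a ∈ wordSpan K g n m) (i : κ) :
    g i * a ∈ wordSpan K g n (m + 1) := by
  induction ha using Submodule.span_induction with
  | mem x hx =>
    obtain ⟨w, h1, h2, rfl⟩ := hx
    rw [← word_cons]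
    exact word_mem_wordSpan (by simp; omega) (by simp; omega)
  | zero => simp
  | add x y _ _ hx hy => rw [mul_add]; exact add_mem hx hy
  | smul c x _ hx => rw [mul_smul_comm]; exact Submodule.smul_mem _ _ hx

/-- Permuting the letters of a word changes it by shorter words. -/
theorem word_sub_word_mem {n : ℕ}
    (hg : ∀ i j, g i * g j - g j * g i ∈ wordSpan K g n 2) {l l' : List κ} (h : l.Perm l') :
    word g l - word g l' ∈ wordSpan K g n l.length := by
  induction h with
  | nil => simp
  | cons i _ ih =>
    rw [word_cons, word_cons, ← mul_sub, List.length_cons]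
    exact cons_mul_mem ih i
  | swap i j l =>
    have := mul_word_mem (hg j i) l
    simp only [word_cons, List.length_cons, ← mul_assoc, ← sub_mul]
    rwa [show l.length + 1 + 1 = 2 + l.length by omega]
  | trans h₁ _ ih₁ ih₂ =>
    rw [← h₁.length_eq] at ih₂
    simpa using add_mem ih₁ ih₂

/-- If every multiset of letters is represented by some list, words of length at least `n` are
combinations of the words attached to the multisets of cardinality at least `n`. -/
theorem word_mem_span_section {n : ℕ}
    (hg : ∀ i j, g i * g j - g j * g i ∈ wordSpan K g n 2) {s : Multiset κ → List κ}
    (hs : ∀ m : Multiset κ, (s m : Multiset κ) = m) (l : List κ) (hl : n ≤ l.length) :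
    word g l ∈ Submodule.span K {a | ∃ m : Multiset κ, n ≤ m.card ∧ word g (s m) = a} := by
  induction h : l.length using Nat.strong_induction_on generalizing l with
  | _ k ih =>
    subst h
    have hp : l.Perm (s l) := (Multiset.coe_eq_coe.1 (hs l)).symm
    rw [← sub_add_cancel (word g l) (word g (s l))]
    refine add_mem ?_ (Submodule.subset_span ⟨l, by simpa using hl, rfl⟩)
    refine (Submodule.span_le.2 ?_) (word_sub_word_mem hg hp)
    rintro _ ⟨w, hw, hw', rfl⟩
    exact ih _ hw' w hw rfl

end WordSpan

/-! ### Linear independence of standard monomials in the enveloping algebra -/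

namespace AdjointPolynomials

open MvPolynomial

/-- A derivation lowers the powers of an ideal by at most one. -/
theorem derivation_mem_pow {R A : Type*} [CommRing R] [CommRing A] [Algebra R A]
    (D : Derivation R A A) (I : Ideal A) (n : ℕ) {a : A} (ha : a ∈ I ^ (n + 1)) :
    D a ∈ I ^ n := by
  induction n generalizing a with
  | zero => simp
  | succ n ih =>
    rw [pow_succ'] at ha
    induction ha using Submodule.mul_induction_on' with
    | mem_mul_mem x hx y hy =>
      rw [D.leibniz, smul_eq_mul, smul_eq_mul]
      refine add_mem ?_ (Ideal.mul_mem_right _ _ hy)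
      rw [pow_succ']
      exact Ideal.mul_mem_mul hx (ih hy)
    | add x _ y _ hx hy => rw [map_add]; exact add_mem hx hy

variable {K 𝔤 κ : Type*} [Field K] [LieRing 𝔤] [LieAlgebra K 𝔤] [Fintype κ]
  (e : Module.Basis κ K 𝔤)

/-- The derivation of the polynomial functions on square matrices that is induced by the adjoint
action of an element of `𝔤`. -/
noncomputable def der (x : 𝔤) : Derivation K (MvPolynomial (κ × κ) K) (MvPolynomial (κ × κ) K) :=
  mkDerivation K fun p => ∑ l, e.repr ⁅x, e p.2⁆ l • X (p.1, l)

theorem der_X (x : 𝔤) (p : κ × κ) :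
    der e x (X p) = ∑ l, e.repr ⁅x, e p.2⁆ l • X (p.1, l) := mkDerivation_X _ _ _

theorem sum_repr_lie (x y : 𝔤) (k : κ) :
    ∑ l, e.repr y l * e.repr ⁅x, e l⁆ k = e.repr ⁅x, y⁆ k := by
  conv_rhs => rw [← e.sum_repr y, lie_sum, map_sum, Finsupp.finsetSum_apply]
  simp

/-- The action of `𝔤` on polynomial functions on matrices. -/
noncomputable def action : 𝔤 →ₗ⁅K⁆ Module.End K (MvPolynomial (κ × κ) K) where
  toFun x := (der e x).toLinearMap
  map_add' x y := by
    have : der e (x + y) = der e x + der e y := by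
      refine MvPolynomial.derivation_ext fun p => ?_
      simp [der_X, add_smul, Finset.sum_add_distrib]
    rw [this]; rfl
  map_smul' c x := by
    have : der e (c • x) = c • der e x := by
      refine MvPolynomial.derivation_ext fun p => ?_
      simp [der_X, Finset.smul_sum, smul_smul]
    rw [this]; rfl
  map_lie' := fun {x y} => by
    have : der e ⁅x, y⁆ = ⁅der e x, der e y⁆ := by
      refine MvPolynomial.derivation_ext fun p => ?_
      have key : ∀ x y : 𝔤, der e x (der e y (X p))
          = ∑ k, e.repr ⁅x, ⁅y, e p.2⁆⁆ k • X (p.1, k) := by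
        intro x y
        simp only [der_X, map_sum, Derivation.map_smul, Finset.smul_sum, smul_smul]
        rw [Finset.sum_comm]
        refine Finset.sum_congr rfl fun k _ => ?_
        rw [← Finset.sum_smul, sum_repr_lie]
      rw [Derivation.commutator_apply, key, key, der_X, ← Finset.sum_sub_distrib]
      simp only [lie_lie, map_sub, Finsupp.sub_apply, sub_smul]
    rw [this]
    ext a
    simp [LieRing.of_associative_ring_bracket]

theorem action_apply (x : 𝔤) (a : MvPolynomial (κ × κ) K) : action e x a = der e x a := rfl

variable [DecidableEq κ]

variable (K κ) in
/-- Evaluation at the identity matrix. -/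
noncomputable def evalOne : MvPolynomial (κ × κ) K →ₐ[K] K :=
  aeval fun p => if p.1 = p.2 then 1 else 0

variable (K κ) in
/-- The ideal of the identity matrix. -/
noncomputable abbrev idealOne : Ideal (MvPolynomial (κ × κ) K) := RingHom.ker (evalOne K κ)

theorem evalOne_der_X (x : 𝔤) (p : κ × κ) :
    evalOne K κ (der e x (X p)) = e.repr ⁅x, e p.2⁆ p.1 := by
  simp [der_X, evalOne]

/-- If the centre of `𝔤` is trivial, there are functions on matrices which are local coordinates at
the identity matrix along `𝔤`. -/
theorem exists_coordinates (h𝔤 : ∀ x : 𝔤, (∀ y : 𝔤, ⁅x, y⁆ = 0) → x = 0) :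
    ∃ t : κ → MvPolynomial (κ × κ) K, (∀ i, t i ∈ idealOne K κ) ∧
      ∀ i j, der e (e j) (t i) - (if i = j then 1 else 0) ∈ idealOne K κ := by
  let T : 𝔤 →ₗ[K] (κ × κ → K) :=
    { toFun := fun x p => e.repr ⁅x, e p.2⁆ p.1
      map_add' := fun x y => by ext; simp
      map_smul' := fun c x => by ext; simp }
  have hT : LinearMap.ker T = ⊥ := by
    refine (Submodule.eq_bot_iff _).2 fun x hx => h𝔤 x fun y => ?_
    have h1 : ∀ i, ⁅x, e i⁆ = 0 := fun i => by
      refine e.repr.injective (Finsupp.ext fun k => ?_)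
      simpa [T] using congrFun (LinearMap.mem_ker.1 hx) (k, i)
    rw [← e.sum_repr y, lie_sum]
    simp [h1]
  obtain ⟨S, hS⟩ := T.exists_leftInverse_of_injective hT
  have hS' : ∀ i j, ∑ p, (e.repr (S (Pi.single p 1)) i) * T (e j) p = if i = j then 1 else 0 := by
    intro i j
    have h1 : S (T (e j)) = e j := LinearMap.congr_fun hS _
    have h2 : T (e j) = ∑ p, T (e j) p • Pi.single p (1 : K) := by
      ext q; simp [Finset.sum_apply, Pi.single_apply]
    rw [h2] at h1
    have h3 := congrArg (fun v => e.repr v i) h1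
    simp only [map_sum, map_smul, Finsupp.finsetSum_apply, Finsupp.smul_apply, smul_eq_mul,
      e.repr_self, Finsupp.single_apply] at h3
    rw [Finset.sum_congr rfl fun p _ => mul_comm _ _, h3]
    simp only [eq_comm]
  refine ⟨fun i => ∑ p, (e.repr (S (Pi.single p 1)) i) • (X p - C (evalOne K κ (X p))),
    fun i => ?_, fun i j => ?_⟩
  · rw [RingHom.mem_ker]
    simp [evalOne]
  · rw [RingHom.mem_ker, map_sub, map_sum, map_sum]
    simp only [Derivation.map_smul, map_sub, map_smul, evalOne_der_X, smul_eq_mul]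
    rw [sub_eq_zero]
    refine Eq.trans ?_ ((hS' i j).trans ?_)
    · refine Finset.sum_congr rfl fun p _ => ?_
      rw [show der e (e j) (C _) = 0 from derivation_C _ _]
      simp [T]
    · split_ifs <;> simp

variable {e} {t : κ → MvPolynomial (κ × κ) K}

omit [Fintype κ] in
theorem prod_mem_pow (ht : ∀ i, t i ∈ idealOne K κ) (s : Multiset κ) :
    (s.map t).prod ∈ idealOne K κ ^ s.card := by
  induction s using Multiset.induction_on with
  | empty => simp
  | cons a s ih =>
    rw [Multiset.map_cons, Multiset.prod_cons, Multiset.card_cons, pow_succ']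
    exact Ideal.mul_mem_mul (ht a) ih

/-- To leading order, the basis element `e j` acts on monomials in the coordinates as a partial
derivative. -/
theorem der_prod_sub_mem (ht : ∀ i, t i ∈ idealOne K κ)
    (hd : ∀ i j, der e (e j) (t i) - (if i = j then 1 else 0) ∈ idealOne K κ)
    (j : κ) (s : Multiset κ) :
    der e (e j) (s.map t).prod - s.count j • ((s.erase j).map t).prod
      ∈ idealOne K κ ^ s.card := by
  induction s using Multiset.induction_on with
  | empty => simp
  | cons a s ih =>
    rw [Multiset.map_cons, Multiset.prod_cons, Multiset.card_cons, Derivation.leibniz]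
    have h1 := Ideal.mul_mem_mul (ht a) ih
    have h2 := Ideal.mul_mem_mul (hd a j) (prod_mem_pow ht s)
    rw [← pow_succ'] at h1 h2
    convert add_mem h1 h2 using 1
    have h3 : t a * (s.count j • ((s.erase j).map t).prod)
        = s.count j • (((a ::ₘ s).erase j).map t).prod := by
      by_cases haj : a = j
      · subst haj
        by_cases has : a ∈ s
        · rw [Multiset.erase_cons_head, mul_smul_comm, Multiset.prod_map_erase has]
        · simp [Multiset.count_eq_zero_of_notMem has]
      · rw [Multiset.erase_cons_tail _ (by simpa using haj), mul_smul_comm, Multiset.map_cons,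
          Multiset.prod_cons]
    rw [mul_sub, h3]
    by_cases haj : a = j
    · subst haj
      simp only [Multiset.count_cons_self, smul_eq_mul, Multiset.erase_cons_head, if_true, add_smul,
        one_smul]
      ring
    · simp only [Multiset.count_cons_of_ne (Ne.symm haj), smul_eq_mul, if_neg haj]
      ring

variable [CharZero K] (e) (c : κ → K)

/-- The shifted basis elements `e i - c i` of the enveloping algebra. -/
noncomputable def shifted (i : κ) : UniversalEnvelopingAlgebra K 𝔤 :=
  UniversalEnvelopingAlgebra.ι K (e i) - algebraMap K _ (c i)

/-- The action of the enveloping algebra on polynomial functions on matrices. -/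
noncomputable abbrev envAction :
    UniversalEnvelopingAlgebra K 𝔤 →ₐ[K] Module.End K (MvPolynomial (κ × κ) K) :=
  UniversalEnvelopingAlgebra.lift K (action e)

omit [DecidableEq κ] [CharZero K] in
theorem envAction_shifted (i : κ) (a : MvPolynomial (κ × κ) K) :
    envAction e (shifted e c i) a = der e (e i) a - c i • a := by
  rw [shifted, map_sub, AlgHom.commutes, UniversalEnvelopingAlgebra.lift_ι_apply]
  simp [action_apply, Module.algebraMap_end_apply]

open WordSpan

omit [CharZero K] in
theorem envAction_word_mem (l : List κ) {n : ℕ} {a : MvPolynomial (κ × κ) K}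
    (ha : a ∈ idealOne K κ ^ (n + l.length)) :
    envAction e (word (shifted e c) l) a ∈ idealOne K κ ^ n := by
  induction l generalizing n with
  | nil => simpa using ha
  | cons i l ih =>
    rw [List.length_cons, show n + (l.length + 1) = (n + 1) + l.length by omega] at ha
    have h := ih ha
    rw [word_cons, map_mul, Module.End.mul_apply, envAction_shifted]
    refine sub_mem (derivation_mem_pow _ _ _ h) ?_
    rw [← algebraMap_smul (MvPolynomial (κ × κ) K) (c i)]
    exact Submodule.smul_mem _ _ (Ideal.pow_le_pow_right n.le_succ h)

omit [CharZero K] in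
theorem evalOne_word_eq_zero (l : List κ) {n : ℕ} {a : MvPolynomial (κ × κ) K}
    (ha : a ∈ idealOne K κ ^ n) (hn : l.length < n) :
    evalOne K κ (envAction e (word (shifted e c) l) a) = 0 := by
  have h : a ∈ idealOne K κ ^ (1 + l.length) := Ideal.pow_le_pow_right (by omega) ha
  simpa using envAction_word_mem e c l h

variable {e}

omit [CharZero K] in
theorem evalOne_word_concat (ht : ∀ i, t i ∈ idealOne K κ)
    (hd : ∀ i j, der e (e j) (t i) - (if i = j then 1 else 0) ∈ idealOne K κ)
    (l : List κ) (j : κ) (s : Multiset κ) (hs : s.card = l.length + 1) :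
    evalOne K κ (envAction e (word (shifted e c) (l ++ [j])) (s.map t).prod)
      = s.count j * evalOne K κ (envAction e (word (shifted e c) l) ((s.erase j).map t).prod) := by
  rw [word_append, map_mul, Module.End.mul_apply, word_cons, word_nil, mul_one, envAction_shifted]
  have h1 := evalOne_word_eq_zero e c l (der_prod_sub_mem ht hd j s) (by omega)
  have h2 := evalOne_word_eq_zero e c l (prod_mem_pow ht s) (by omega)
  rw [map_sub, map_sub, sub_eq_zero] at h1
  rw [map_sub, map_sub, map_smul, map_smul, h1, h2, smul_zero, sub_zero, map_nsmul, map_nsmul,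
    nsmul_eq_mul]

theorem evalOne_word_prod (ht : ∀ i, t i ∈ idealOne K κ)
    (hd : ∀ i j, der e (e j) (t i) - (if i = j then 1 else 0) ∈ idealOne K κ)
    (l : List κ) (s : Multiset κ) (hs : s.card = l.length) :
    evalOne K κ (envAction e (word (shifted e c) l) (s.map t).prod) = 0 ↔ (l : Multiset κ) ≠ s := by
  induction l using List.reverseRecOn generalizing s with
  | nil =>
    obtain rfl : s = 0 := by simpa using hs
    simp
  | append_singleton l j ih =>
    rw [List.length_append, List.length_singleton] at hs
    rw [evalOne_word_concat c ht hd l j s hs]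
    by_cases hj : j ∈ s
    · obtain ⟨s, rfl⟩ := Multiset.exists_cons_of_mem hj
      rw [Multiset.card_cons, Nat.add_right_cancel_iff] at hs
      rw [Multiset.erase_cons_head, mul_eq_zero, ih s hs,
        or_iff_right (by simp only [Multiset.count_cons_self]; exact Nat.cast_ne_zero.2 (Nat.succ_ne_zero _))]
      have : ((l ++ [j] : List κ) : Multiset κ) = j ::ₘ (l : Multiset κ) := by
        rw [Multiset.cons_coe, Multiset.coe_eq_coe]
        exact List.perm_append_singleton j l
      rw [this, Ne, Ne, Multiset.cons_inj_right]
    · rw [Multiset.count_eq_zero_of_notMem hj]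
      simp only [Nat.cast_zero, zero_mul, true_iff]
      rintro rfl
      exact hj (by simp)

/-- Linear independence of standard monomials: choosing a word in shifted basis elements for each
multiset of letters gives a linearly independent family. -/
theorem linearIndependent_word (h𝔤 : ∀ x : 𝔤, (∀ y : 𝔤, ⁅x, y⁆ = 0) → x = 0)
    {s : Multiset κ → List κ} (hs : ∀ m : Multiset κ, (s m : Multiset κ) = m) :
    LinearIndependent K fun m => word (shifted e c) (s m) := by
  obtain ⟨t, ht, hd⟩ := exists_coordinates e h𝔤
  rw [linearIndependent_iff]
  intro l hl
  by_contra hne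
  obtain ⟨m, hm, hmax⟩ := l.support.exists_max_image Multiset.card
    (Finsupp.support_nonempty_iff.2 hne)
  have hcard : ∀ m, (s m).length = m.card := fun m => by
    conv_rhs => rw [← hs m]
    simp
  have h0 := congrArg (fun u => evalOne K κ (envAction e u (m.map t).prod)) hl
  simp only [Finsupp.linearCombination_apply, Finsupp.sum, map_sum, map_smul, map_zero,
    LinearMap.sum_apply, LinearMap.smul_apply, LinearMap.zero_apply] at h0
  rw [Finset.sum_eq_single m] at h0
  · rw [smul_eq_zero] at h0
    refine h0.elim (Finsupp.mem_support_iff.1 hm) fun h => ?_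
    exact (evalOne_word_prod c ht hd (s m) m (hcard m).symm).1 h (hs m)
  · intro m' hm' hne'
    rw [smul_eq_zero]
    right
    rcases (hmax m' hm').lt_or_eq with h | h
    · exact evalOne_word_eq_zero e c (s m') (prod_mem_pow ht m) (by rwa [hcard])
    · exact (evalOne_word_prod c ht hd (s m') m (by rw [hcard, h])).2 (by rwa [hs])
  · exact fun h => absurd hm h

end AdjointPolynomials

namespace InducedModule

open WordSpan AdjointPolynomials UniversalEnvelopingAlgebra

variable {K 𝔤 : Type*} [Field K] [LieRing 𝔤] [LieAlgebra K 𝔤]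

theorem adjoin_range_ι :
    Algebra.adjoin K (Set.range (ι K : 𝔤 → UniversalEnvelopingAlgebra K 𝔤)) = ⊤ := by
  let S := Algebra.adjoin K (Set.range (ι K : 𝔤 → UniversalEnvelopingAlgebra K 𝔤))
  let f : 𝔤 →ₗ⁅K⁆ S :=
    { toFun := fun x => ⟨ι K x, Algebra.subset_adjoin ⟨x, rfl⟩⟩
      map_add' := fun x y => Subtype.ext (map_add (ι K) x y)
      map_smul' := fun c x => Subtype.ext (map_smul (ι K) c x)
      map_lie' := fun {x y} => Subtype.ext (LieHom.map_lie (ι K) x y) }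
  have h : S.val.comp (lift K f) = AlgHom.id K _ := by
    refine hom_ext K (LieHom.ext fun x => ?_)
    change S.val (lift K f (ι K x)) = ι K x
    rw [lift_ι_apply]
    rfl
  refine eq_top_iff.2 fun u _ => ?_
  have hu := DFunLike.congr_fun h u
  rw [AlgHom.id_apply] at hu
  rw [← hu]
  exact (lift K f u).2

variable {κ : Type*}

theorem word_map {A κ' : Type*} [Ring A] (g : κ → A) (f : κ' → κ) (l : List κ') :
    word g (l.map f) = word (g ∘ f) l := by
  simp [word]

/-- The words in the shifted elements of a basis span the enveloping algebra. -/
theorem span_word_shifted [Fintype κ] (e : Module.Basis κ K 𝔤) (c : κ → K) :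
    Submodule.span K (Set.range (word (shifted e c))) = ⊤ := by
  have h1 : Algebra.adjoin K (Set.range (shifted e c)) = ⊤ := by
    rw [← top_le_iff, ← adjoin_range_ι, Algebra.adjoin_le_iff]
    rintro _ ⟨x, rfl⟩
    rw [← e.sum_repr x, map_sum]
    refine sum_mem fun i _ => ?_
    rw [map_smul]
    refine Subalgebra.smul_mem _ ?_ _
    have : ι K (e i) = shifted e c i + algebraMap K _ (c i) := by simp [shifted]
    rw [this]
    exact add_mem (Algebra.subset_adjoin ⟨i, rfl⟩) (Subalgebra.algebraMap_mem _ _)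
  have h2 := congrArg Subalgebra.toSubmodule h1
  rw [Algebra.adjoin_eq_span, Algebra.top_toSubmodule] at h2
  rw [← top_le_iff, ← h2]
  refine Submodule.span_mono fun u hu => ?_
  induction hu using Submonoid.closure_induction with
  | mem x hx => obtain ⟨i, rfl⟩ := hx; exact ⟨[i], by simp⟩
  | one => exact ⟨[], rfl⟩
  | mul x y _ _ hx hy =>
    obtain ⟨a, rfl⟩ := hx
    obtain ⟨b, rfl⟩ := hy
    exact ⟨a ++ b, by simp⟩

theorem shifted_comm [Fintype κ] (e : Module.Basis κ K 𝔤) (c : κ → K) (i j : κ) :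
    shifted e c i * shifted e c j - shifted e c j * shifted e c i = ι K ⁅e i, e j⁆ := by
  rw [LieHom.map_lie, LieRing.of_associative_ring_bracket, shifted, shifted]
  have h := Algebra.commutes (c i) (ι K (e j))
  have h' := Algebra.commutes (c j) (ι K (e i))
  have h'' := Algebra.commutes (c j) (algebraMap K (UniversalEnvelopingAlgebra K 𝔤) (c i))
  simp only [sub_mul, mul_sub, h, h', h'']
  abel

variable {α β : Type*}

/-- The list attached to a multiset of letters of two kinds, with the letters of the first kind
put first. -/
noncomputable def splitList (m : Multiset (α ⊕ β)) : List (α ⊕ β) :=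
  (m.filterMap Sum.getLeft?).toList.map Sum.inl ++ (m.filterMap Sum.getRight?).toList.map Sum.inr

theorem coe_splitList (m : Multiset (α ⊕ β)) : (splitList m : Multiset (α ⊕ β)) = m := by
  rw [splitList, ← Multiset.coe_add, ← Multiset.map_coe, ← Multiset.map_coe, Multiset.coe_toList,
    Multiset.coe_toList]
  induction m using Multiset.induction_on with
  | empty => simp
  | cons a m ih => 
    rcases a with a | b
    · rw [Multiset.filterMap_cons_some _ _ _ (Sum.getLeft?_inl (x := a)),
        Multiset.filterMap_cons_none _ _ Sum.getRight?_inl, Multiset.map_cons, Multiset.cons_add, ih]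
    · rw [Multiset.filterMap_cons_none _ _ Sum.getLeft?_inr,
        Multiset.filterMap_cons_some _ _ _ (Sum.getRight?_inr (x := b)), Multiset.map_cons,
        Multiset.add_cons, ih]

theorem filterMap_none {α β : Type*} (m : Multiset α) :
    m.filterMap (fun _ => (none : Option β)) = 0 := by
  induction m using Multiset.induction_on with
  | empty => simp
  | cons a m ih => rwa [Multiset.filterMap_cons_none _ _ rfl]

theorem splitList_map_add (m : Multiset α) (n : Multiset β) :
    splitList (m.map Sum.inl + n.map Sum.inr) = m.toList.map Sum.inl ++ n.toList.map Sum.inr := by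
  have h1 : (m.map Sum.inl + n.map Sum.inr : Multiset (α ⊕ β)).filterMap Sum.getLeft? = m := by
    rw [Multiset.filterMap_add, Multiset.filterMap_map, Multiset.filterMap_map]
    simp [Function.comp_def, filterMap_none]
  have h2 : (m.map Sum.inl + n.map Sum.inr : Multiset (α ⊕ β)).filterMap Sum.getRight? = n := by
    rw [Multiset.filterMap_add, Multiset.filterMap_map, Multiset.filterMap_map]
    simp [Function.comp_def, filterMap_none]
  rw [splitList, h1, h2]

variable [Fintype α] [Fintype β] [DecidableEq α] [DecidableEq β] [CharZero K]

/-- The basis of standard monomials of the enveloping algebra. -/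
noncomputable def splitBasis (e : Module.Basis (α ⊕ β) K 𝔤) (c : α ⊕ β → K)
    (h𝔤 : ∀ x : 𝔤, (∀ y : 𝔤, ⁅x, y⁆ = 0) → x = 0) :
    Module.Basis (Multiset (α ⊕ β)) K (UniversalEnvelopingAlgebra K 𝔤) :=
  Module.Basis.mk (linearIndependent_word c h𝔤 (s := splitList) coe_splitList) <| by
    rw [← span_word_shifted e c, Submodule.span_le]
    rintro _ ⟨l, rfl⟩
    have hg : ∀ i j, shifted e c i * shifted e c j - shifted e c j * shifted e c i
        ∈ wordSpan K (shifted e c) 0 2 := by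
      intro i j
      rw [shifted_comm, ← e.sum_repr ⁅e i, e j⁆, map_sum]
      refine sum_mem fun k _ => ?_
      rw [map_smul]
      refine Submodule.smul_mem _ _ ?_
      have h : ι K (e k) = word (shifted e c) [k] + c k • word (shifted e c) [] := by
        simp [shifted, Algebra.algebraMap_eq_smul_one]
      rw [h]
      exact add_mem (word_mem_wordSpan (by simp) (by simp))
        (Submodule.smul_mem _ _ (word_mem_wordSpan (by simp) (by simp)))
    refine Submodule.span_mono ?_ (word_mem_span_section hg coe_splitList l (Nat.zero_le _))
    rintro _ ⟨m, _, rfl⟩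
    exact ⟨m, rfl⟩

theorem splitBasis_apply (e : Module.Basis (α ⊕ β) K 𝔤) (c : α ⊕ β → K)
    (h𝔤 : ∀ x : 𝔤, (∀ y : 𝔤, ⁅x, y⁆ = 0) → x = 0) (m : Multiset (α ⊕ β)) :
    splitBasis e c h𝔤 m = word (shifted e c) (splitList m) := by
  simp [splitBasis]

/-- Multiplying on the right by a letter of the second kind gives combinations of standard
monomials with at least one letter of the second kind. -/
theorem mul_shifted_inr_mem (e : Module.Basis (α ⊕ β) K 𝔤) (c : α ⊕ β → K)
    (h𝔤 : ∀ x : 𝔤, (∀ y : 𝔤, ⁅x, y⁆ = 0) → x = 0)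
    (hc : ∀ k l : β, shifted e c (.inr k) * shifted e c (.inr l)
      - shifted e c (.inr l) * shifted e c (.inr k)
        ∈ wordSpan K (shifted e c ∘ Sum.inr) 1 2)
    (u : UniversalEnvelopingAlgebra K 𝔤) (k : β) :
    u * shifted e c (.inr k) ∈ Submodule.span K
      {a | ∃ (m : Multiset α) (n : Multiset β), n ≠ 0 ∧
        splitBasis e c h𝔤 (m.map Sum.inl + n.map Sum.inr) = a} := by
  have hu := (splitBasis e c h𝔤).mem_span u
  induction hu using Submodule.span_induction with
  | zero => simp
  | add x y _ _ hx hy => rw [add_mul]; exact add_mem hx hy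
  | smul r x _ hx => rw [smul_mul_assoc]; exact Submodule.smul_mem _ _ hx
  | mem x hx =>
    obtain ⟨m, rfl⟩ := hx
    rw [splitBasis_apply, splitList, word_append, mul_assoc, word_map _ Sum.inr]
    set a := m.filterMap Sum.getLeft?
    set l := (m.filterMap Sum.getRight?).toList
    have hl : word (shifted e c ∘ Sum.inr) l * shifted e c (.inr k)
        = word (shifted e c ∘ Sum.inr) (l ++ [k]) := by simp
    rw [hl]
    have h := word_mem_span_section hc (s := Multiset.toList) Multiset.coe_toList (l ++ [k])
      (by simp)
    refine Submodule.mem_comap (f := LinearMap.mulLeft K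
      (word (shifted e c) (a.toList.map Sum.inl))).1 (Submodule.span_le.2 ?_ h)
    rintro _ ⟨n, hn, rfl⟩
    refine Submodule.subset_span ⟨a, n, ?_, ?_⟩
    · rintro rfl; simp at hn
    · rw [splitBasis_apply, splitList_map_add, word_append, word_map _ Sum.inr]
      rfl

/-- An element of a Lie algebra with trivial centre that lies in the left ideal of the enveloping
algebra generated by the elements `z - χ z` for a character `χ` of a subalgebra belongs to this
subalgebra. -/
theorem mem_of_ι_mem_span [FiniteDimensional K 𝔤]
    (h𝔤 : ∀ x : 𝔤, (∀ y : 𝔤, ⁅x, y⁆ = 0) → x = 0) (𝔪 : LieSubalgebra K 𝔤) (χ : 𝔪 →ₗ[K] K)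
    (hχ : ∀ x y : 𝔪, χ ⁅x, y⁆ = 0) {y : 𝔤}
    (hy : ι K y ∈ Ideal.span (Set.range fun z : 𝔪 =>
      (ι K (z : 𝔤) - algebraMap K (UniversalEnvelopingAlgebra K 𝔤) (χ z)))) : y ∈ 𝔪 := by
  obtain ⟨C, hC⟩ := Submodule.exists_isCompl 𝔪.toSubmodule
  let b₁ := Module.finBasis K C
  let b₂ : Module.Basis _ K 𝔪 := Module.finBasis K 𝔪
  let e := (b₁.prod b₂).map (Submodule.prodEquivOfIsCompl C 𝔪.toSubmodule hC.symm)
  have he₂ : ∀ k, e (.inr k) = b₂ k := fun k => by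
    rw [Module.Basis.map_apply, Submodule.coe_prodEquivOfIsCompl', Module.Basis.prod_apply_inr_fst,
      Module.Basis.prod_apply_inr_snd, Submodule.coe_zero, zero_add]
  let c : Fin (Module.finrank K C) ⊕ Fin (Module.finrank K 𝔪) → K :=
    Sum.elim (fun _ => 0) (fun k => χ (b₂ k))
  have hsh : ∀ z : 𝔪, ι K (z : 𝔤) - algebraMap K (UniversalEnvelopingAlgebra K 𝔤) (χ z)
      = ∑ k, b₂.repr z k • shifted e c (.inr k) := by
    intro z
    let ρ : 𝔪 →ₗ[K] UniversalEnvelopingAlgebra K 𝔤 :=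
      (ι K (L := 𝔤)).toLinearMap.comp 𝔪.toSubmodule.subtype - (Algebra.linearMap K _).comp χ
    have hρ : ∀ k, ρ (b₂ k) = shifted e c (.inr k) := fun k => by
      rw [shifted, he₂]; rfl
    change ρ z = _
    conv_lhs => rw [← b₂.sum_repr z]
    simp only [map_sum, map_smul, hρ]
  have hc : ∀ k l, shifted e c (.inr k) * shifted e c (.inr l)
      - shifted e c (.inr l) * shifted e c (.inr k)
        ∈ wordSpan K (shifted e c ∘ Sum.inr) 1 2 := by
    intro k l
    have h := hsh ⁅b₂ k, b₂ l⁆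
    rw [hχ, map_zero, sub_zero, LieSubalgebra.coe_bracket] at h
    rw [shifted_comm, he₂, he₂, h]
    refine sum_mem fun r _ => Submodule.smul_mem _ _ ?_
    have := word_mem_wordSpan (K := K) (g := shifted e c ∘ Sum.inr) (l := [r]) (n := 1) (m := 2)
      (by simp) (by simp)
    simpa using this
  let 𝓑 := splitBasis e c h𝔤
  have hcoord : ∀ i, 𝓑.coord {.inl i} (ι K y) = 0 := by
    intro i
    generalize ι K y = v at hy
    induction hy using Submodule.closure_induction with
    | zero => simp
    | add x y _ _ hx hy => rw [map_add, hx, hy, add_zero]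
    | smul_mem u x hx =>
      obtain ⟨z, rfl⟩ := hx
      beta_reduce
      rw [smul_eq_mul, hsh, Finset.mul_sum, map_sum]
      refine Finset.sum_eq_zero fun k _ => ?_
      rw [mul_smul_comm, map_smul]
      refine smul_eq_zero_of_right _ ?_
      have h := mul_shifted_inr_mem e c h𝔤 hc u k
      refine (Submodule.span_le (p := LinearMap.ker (𝓑.coord {.inl i}))).2 ?_ h
      rintro _ ⟨m, n, hn, rfl⟩
      rw [SetLike.mem_coe, LinearMap.mem_ker, Module.Basis.coord_apply, Module.Basis.repr_self,
        Finsupp.single_apply, if_neg]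
      intro h
      obtain ⟨k, hk⟩ := Multiset.exists_mem_of_ne_zero hn
      have : (.inr k : _ ⊕ _) ∈ ({.inl i} : Multiset (_ ⊕ _)) :=
        h ▸ Multiset.mem_add.2 (.inr (Multiset.mem_map_of_mem _ hk))
      simp at this
  have hword : ∀ r, ι K (e r) = 𝓑 {r} + c r • 𝓑 0 := by
    intro r
    have h1 : splitList ({r} : Multiset (_ ⊕ _)) = [r] := by
      rw [← Multiset.coe_eq_singleton, coe_splitList]
    have h0 : splitList (0 : Multiset (Fin (Module.finrank K C) ⊕ Fin (Module.finrank K 𝔪))) = [] := by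
      rw [← Multiset.coe_eq_zero, coe_splitList]
    rw [splitBasis_apply, splitBasis_apply, h1, h0]
    simp [shifted, Algebra.algebraMap_eq_smul_one]
  have hrepr : ∀ i, e.repr y (.inl i) = 0 := by
    intro i
    rw [← hcoord i]
    conv_rhs => rw [← e.sum_repr y, map_sum, map_sum]
    simp only [map_smul, hword, map_add, Module.Basis.coord_apply, Module.Basis.repr_self,
      Finsupp.single_apply, Multiset.singleton_inj, Multiset.zero_ne_singleton, if_false,
      smul_zero, add_zero]
    simp
  rw [← e.sum_repr y]
  refine sum_mem fun r _ => ?_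
  rcases r with i | k
  · rw [hrepr, zero_smul]; exact zero_mem _
  · rw [he₂]; exact 𝔪.smul_mem _ (b₂ k).2

end InducedModule

/-! ### The Euler operator and Whittaker vectors -/

open UniversalEnvelopingAlgebra

/-- A graded Lie algebra with a linear form `χ` of degree `-2` which is a character of a graded
subalgebra `𝔪` containing all components of degree at least `2`, together with a homogeneous basis
`z` of `𝔪` and a dual family `x` for the pairing `χ ⁅·, ·⁆`. -/
structure WhittakerGrading (K 𝔤 κ : Type*) [Field K] [LieRing 𝔤] [LieAlgebra K 𝔤] [Fintype κ] where
  /-- The grading. -/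
  Γ : ℤ → Submodule K 𝔤
  /-- The linear form. -/
  χ : 𝔤 →ₗ[K] K
  /-- The subalgebra. -/
  𝔪 : LieSubalgebra K 𝔤
  /-- The degrees of the basis of `𝔪`. -/
  deg : κ → ℤ
  /-- The basis of `𝔪`. -/
  z : κ → 𝔤
  /-- The dual family. -/
  x : κ → 𝔤
  iSup_eq_top : ⨆ i, Γ i = ⊤
  lie_mem : ∀ {i j : ℤ} {a b : 𝔤}, a ∈ Γ i → b ∈ Γ j → ⁅a, b⁆ ∈ Γ (i + j)
  χ_eq_zero : ∀ {i : ℤ} {a : 𝔤}, a ∈ Γ i → i ≠ 2 → χ a = 0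
  χ_lie : ∀ {a b : 𝔤}, a ∈ 𝔪 → b ∈ 𝔪 → χ ⁅a, b⁆ = 0
  le_𝔪 : ∀ {i : ℤ} {a : 𝔤}, 2 ≤ i → a ∈ Γ i → a ∈ 𝔪
  𝔪_le : 𝔪.toSubmodule ≤ ⨆ (i : ℤ) (_ : 1 ≤ i), 𝔪.toSubmodule ⊓ Γ i
  one_le_deg : ∀ i, 1 ≤ deg i
  z_mem : ∀ i, z i ∈ 𝔪
  z_mem_Γ : ∀ i, z i ∈ Γ (deg i)
  x_mem_Γ : ∀ i, x i ∈ Γ (2 - deg i)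
  dual : ∀ {i : ℤ} {a : 𝔤}, 1 ≤ i → a ∈ 𝔪 → a ∈ Γ i → ∑ k, χ ⁅a, x k⁆ • z k = a

namespace WhittakerGrading

variable {K 𝔤 κ : Type*} [Field K] [LieRing 𝔤] [LieAlgebra K 𝔤] [Fintype κ]
  (W : WhittakerGrading K 𝔤 κ)

/-- The shifted inclusion `a ↦ a - χ a` of `𝔤` into its enveloping algebra. -/
noncomputable def ρ : 𝔤 →ₗ[K] UniversalEnvelopingAlgebra K 𝔤 :=
  (ι K (L := 𝔤)).toLinearMap - (Algebra.linearMap K _).comp W.χ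

theorem ρ_apply (a : 𝔤) : W.ρ a = ι K a - algebraMap K _ (W.χ a) := rfl

theorem ι_eq (a : 𝔤) : ι K a = W.ρ a + algebraMap K _ (W.χ a) := by simp [ρ_apply]

theorem ρ_mul_ρ (a b : 𝔤) : W.ρ a * W.ρ b = W.ρ b * W.ρ a + ι K ⁅a, b⁆ := by
  rw [LieHom.map_lie, LieRing.of_associative_ring_bracket, ρ_apply, ρ_apply]
  have h := Algebra.commutes (W.χ a) (ι K b)
  have h' := Algebra.commutes (W.χ b) (ι K a)
  have h'' := Algebra.commutes (W.χ a) (algebraMap K (UniversalEnvelopingAlgebra K 𝔤) (W.χ b))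
  simp only [sub_mul, mul_sub, h, h', h'']
  abel

/-- Homogeneous elements of the subalgebra `𝔪`. -/
def IsHom (i : ℤ) (a : 𝔤) : Prop := 1 ≤ i ∧ a ∈ W.𝔪 ∧ a ∈ W.Γ i

/-- The Euler operator. -/
noncomputable def euler : UniversalEnvelopingAlgebra K 𝔤 := ∑ k, W.ρ (W.x k) * W.ρ (W.z k)

variable {M : Type*} [AddCommGroup M] [Module (UniversalEnvelopingAlgebra K 𝔤) M]

variable (M) in
/-- The filtration of a module by the vectors that are annihilated by all products of shifted
homogeneous elements of `𝔪` of total degree greater than `p`, and by those of total degree `p` with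
less than `l` factors. -/
def fil (p : ℤ) (l : ℕ) : AddSubgroup M where
  carrier := {v | ∀ w : List (ℤ × 𝔤), (∀ a ∈ w, W.IsHom a.1 a.2) →
    (p < (w.map Prod.fst).sum ∨ p = (w.map Prod.fst).sum ∧ w.length < l) →
    (w.map fun a => W.ρ a.2).prod • v = 0}
  zero_mem' := fun _ _ _ => smul_zero _
  add_mem' := fun ha hb w hw h => by rw [smul_add, ha w hw h, hb w hw h, add_zero]
  neg_mem' := fun ha w hw h => by rw [smul_neg, ha w hw h, neg_zero]

variable {W} {p p' i : ℤ} {l l' : ℕ} {v : M} {a : 𝔤}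

theorem algebraMap_smul_mem (c : K) (hv : v ∈ W.fil M p l) :
    algebraMap K (UniversalEnvelopingAlgebra K 𝔤) c • v ∈ W.fil M p l := by
  intro w hw h
  rw [smul_smul, ← Algebra.commutes, mul_smul, hv w hw h, smul_zero]

theorem fil_mono (h : p < p' ∨ p = p' ∧ l' ≤ l) (hv : v ∈ W.fil M p l) : v ∈ W.fil M p' l' :=
  fun w hw h' => hv w hw (by omega)

theorem eq_zero_of_mem_fil (h : p < 0 ∨ p = 0 ∧ 0 < l) (hv : v ∈ W.fil M p l) : v = 0 := by
  simpa using hv [] (by simp) (by simpa using h)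

theorem ρ_smul_mem (ha : W.IsHom i a) (hv : v ∈ W.fil M p l) :
    W.ρ a • v ∈ W.fil M (p - i) (l - 1) := by
  intro w hw h
  have := hv (w ++ [(i, a)]) (fun b hb => by
      rcases List.mem_append.1 hb with hb | hb
      · exact hw b hb
      · rw [List.mem_singleton.1 hb]; exact ha)
    (by simp only [List.map_append, List.sum_append, List.map_cons, List.map_nil, List.sum_cons,
          List.sum_nil, List.length_append, List.length_cons, List.length_nil]
        omega)
  simpa [mul_smul] using this

theorem mem_fil_of_ρ (hp : 0 < p)
    (h : ∀ i a, W.IsHom i a → W.ρ a • v ∈ W.fil M (p - i) (l - 1)) : v ∈ W.fil M p l := by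
  intro w hw hw'
  induction w using List.reverseRecOn with
  | nil => simp at hw'; omega
  | append_singleton w b _ =>
    simp only [List.map_append, List.sum_append, List.map_cons, List.map_nil, List.sum_cons,
      List.sum_nil, List.length_append, List.length_cons, List.length_nil] at hw'
    have := h b.1 b.2 (hw b (by simp)) w (fun a ha => hw a (by simp [ha])) (by omega)
    simpa [mul_smul] using this

/-- Elements of degree `2 - d` raise the filtration by `d`. -/
theorem ρ_smul_mem_fil {d : ℤ} (ha : a ∈ W.Γ (2 - d)) (hv : v ∈ W.fil M p l) :
    W.ρ a • v ∈ W.fil M (p + d) (l + 1) := by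
  obtain ⟨n, hn⟩ : ∃ n : ℕ, p + d ≤ n := ⟨(p + d).toNat, Int.self_le_toNat _⟩
  induction n generalizing p d l v a with
  | zero =>
    rcases le_or_gt d 0 with hd | hd
    · exact fil_mono (by omega) (ρ_smul_mem ⟨by omega, W.le_𝔪 (by omega) ha, ha⟩ hv)
    · rw [eq_zero_of_mem_fil (by push_cast at hn; omega) hv, smul_zero]
      exact zero_mem _
  | succ n ih =>
    rcases le_or_gt d 0 with hd | hd
    · exact fil_mono (by omega) (ρ_smul_mem ⟨by omega, W.le_𝔪 (by omega) ha, ha⟩ hv)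
    rcases lt_or_ge p 0 with hp | hp
    · rw [eq_zero_of_mem_fil (by omega) hv, smul_zero]
      exact zero_mem _
    refine mem_fil_of_ρ (by omega) fun i b hb => ?_
    have h1 : ⁅b, a⁆ ∈ W.Γ (2 - (d - i)) := by
      convert W.lie_mem hb.2.2 ha using 2
      ring
    have hi := hb.1
    rw [← mul_smul, ρ_mul_ρ, W.ι_eq, add_smul, add_smul, mul_smul]
    refine add_mem ?_ (add_mem ?_ ?_)
    · exact fil_mono (by omega) (ih ha (ρ_smul_mem hb hv) (by push_cast at hn; omega))
    · exact fil_mono (by omega) (ih h1 hv (by push_cast at hn; omega))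
    · by_cases hdi : d = i
      · exact fil_mono (by omega) (algebraMap_smul_mem _ hv)
      · rw [W.χ_eq_zero h1 (by omega), map_zero, zero_smul]
        exact zero_mem _

theorem isHom_z (k : κ) : W.IsHom (W.deg k) (W.z k) := ⟨W.one_le_deg k, W.z_mem k, W.z_mem_Γ k⟩

theorem euler_smul_mem (hv : v ∈ W.fil M p l) : W.euler • v ∈ W.fil M p l := by
  rw [euler, Finset.sum_smul]
  refine sum_mem fun k _ => ?_
  rw [mul_smul]
  exact fil_mono (by omega) (ρ_smul_mem_fil (W.x_mem_Γ k) (ρ_smul_mem (isHom_z k) hv))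

variable (W) in
theorem ρ_mul_euler (ha : W.IsHom i a) :
    W.ρ a * W.euler = W.euler * W.ρ a + W.ρ a
      + ∑ k, (W.ρ ⁅a, W.x k⁆ * W.ρ (W.z k) + W.ρ (W.x k) * W.ρ ⁅a, W.z k⁆) := by
  have h1 : W.ρ a = ∑ k, algebraMap K _ (W.χ ⁅a, W.x k⁆) * W.ρ (W.z k) := by
    conv_lhs => rw [← W.dual ha.1 ha.2.1 ha.2.2]
    simp [Algebra.smul_def]
  have h2 : W.euler * W.ρ a + W.ρ a
      = ∑ k, (W.ρ (W.x k) * W.ρ (W.z k) * W.ρ a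
        + algebraMap K _ (W.χ ⁅a, W.x k⁆) * W.ρ (W.z k)) := by
    rw [Finset.sum_add_distrib, ← h1, euler, Finset.sum_mul]
  rw [h2, euler, Finset.mul_sum, ← Finset.sum_add_distrib]
  refine Finset.sum_congr rfl fun k _ => ?_
  have h3 : W.ρ a * W.ρ (W.z k) = W.ρ (W.z k) * W.ρ a + W.ρ ⁅a, W.z k⁆ := by
    rw [ρ_mul_ρ, W.ι_eq, W.χ_lie ha.2.1 (W.z_mem k), map_zero, add_zero]
  rw [← mul_assoc, ρ_mul_ρ, W.ι_eq, add_mul, mul_assoc, h3]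
  noncomm_ring

/-- The Euler operator acts on the graded pieces of the filtration by the number of factors. -/
theorem euler_sub_smul_mem (hv : v ∈ W.fil M p l) :
    (W.euler - (l : UniversalEnvelopingAlgebra K 𝔤)) • v ∈ W.fil M p (l + 1) := by
  obtain ⟨n, hn⟩ : ∃ n : ℕ, p ≤ n := ⟨p.toNat, Int.self_le_toNat _⟩
  induction n generalizing p l v with
  | zero =>
    by_cases h0 : p < 0 ∨ p = 0 ∧ 0 < l
    · rw [eq_zero_of_mem_fil h0 hv, smul_zero]
      exact zero_mem _
    obtain rfl : l = 0 := by push_cast at hn; omega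
    rw [Nat.cast_zero, sub_zero, euler, Finset.sum_smul]
    refine sum_mem fun k _ => ?_
    have h1 := W.one_le_deg k
    rw [mul_smul, eq_zero_of_mem_fil (by push_cast at hn; omega) (ρ_smul_mem (isHom_z k) hv),
      smul_zero]
    exact zero_mem _
  | succ n ih =>
    rcases le_or_gt p 0 with hp | hp
    · exact ih hv (by omega)
    refine mem_fil_of_ρ hp fun i a ha => ?_
    have hi := ha.1
    rcases l with _ | l
    · rw [Nat.cast_zero, sub_zero]
      exact ρ_smul_mem (l := 0) ha (euler_smul_mem hv)
    have h1 := ih (ρ_smul_mem ha hv) (by push_cast at hn; omega)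
    have h2 : W.ρ a * (W.euler - ((l + 1 : ℕ) : UniversalEnvelopingAlgebra K 𝔤))
        = (W.euler - ((l + 1 - 1 : ℕ) : UniversalEnvelopingAlgebra K 𝔤)) * W.ρ a
          + ∑ k, (W.ρ ⁅a, W.x k⁆ * W.ρ (W.z k) + W.ρ (W.x k) * W.ρ ⁅a, W.z k⁆) := by
      rw [mul_sub, W.ρ_mul_euler ha, Nat.add_sub_cancel, Nat.cast_add, Nat.cast_one, mul_add,
        ← Nat.cast_comm]
      noncomm_ring
    rw [← mul_smul, h2, add_smul, mul_smul, Finset.sum_smul]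
    refine add_mem h1 (sum_mem fun k _ => ?_)
    rw [add_smul, mul_smul, mul_smul]
    have hk := W.one_le_deg k
    refine add_mem ?_ ?_
    · have h3 : ⁅a, W.x k⁆ ∈ W.Γ (2 - (W.deg k - i)) := by
        convert W.lie_mem ha.2.2 (W.x_mem_Γ k) using 2
        ring
      exact fil_mono (by omega) (ρ_smul_mem_fil h3 (ρ_smul_mem (isHom_z k) hv))
    · have h3 : W.IsHom (i + W.deg k) ⁅a, W.z k⁆ :=
        ⟨by omega, W.𝔪.lie_mem ha.2.1 (W.z_mem k), W.lie_mem ha.2.2 (W.z_mem_Γ k)⟩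
      exact fil_mono (by omega) (ρ_smul_mem_fil (W.x_mem_Γ k) (ρ_smul_mem h3 hv))

theorem mem_fil_pred {n : ℕ} (hv : v ∈ W.fil M (n + 1 : ℕ) (n + 2)) : v ∈ W.fil M n 0 := by
  intro w hw h
  refine hv w hw ?_
  have : (w.length : ℤ) ≤ (w.map Prod.fst).sum := by
    clear h hv
    induction w with
    | nil => simp
    | cons a w ih =>
      have h1 := (hw a (by simp)).1
      have h2 := ih fun b hb => hw b (by simp [hb])
      simp only [List.length_cons, List.map_cons, List.sum_cons]
      push_cast
      omega
  push_cast
  omega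

open Polynomial in
/-- Some polynomial in the Euler operator with constant coefficient `1` maps a given vector to a
Whittaker vector. -/
theorem exists_aeval_euler_smul_mem [CharZero K] {n : ℕ} (hv : v ∈ W.fil M n 0) :
    ∃ P : K[X], P.coeff 0 = 1 ∧ aeval W.euler P • v ∈ W.fil M 0 0 := by
  induction n generalizing v with
  | zero => exact ⟨1, by simp, by simpa using hv⟩
  | succ n ih =>
    have key : ∀ l : ℕ, ∃ P : K[X], P.coeff 0 = 1 ∧
        aeval W.euler P • v ∈ W.fil M (n + 1 : ℕ) (l + 1) := by
      intro l
      induction l with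
      | zero =>
        refine ⟨1, by simp, ?_⟩
        rw [map_one, one_smul]
        exact mem_fil_of_ρ (by omega) fun i a ha => ρ_smul_mem (l := 0) ha hv
      | succ l ih =>
        obtain ⟨P, hP, hPv⟩ := ih
        refine ⟨(1 - C ((l + 1 : K)⁻¹) * X) * P, by simp [mul_coeff_zero, hP], ?_⟩
        have hl : (l + 1 : K) ≠ 0 := by exact_mod_cast Nat.succ_ne_zero l
        have h1 := algebraMap_smul_mem (-(l + 1 : K)⁻¹) (euler_sub_smul_mem hPv)
        rw [map_mul, mul_smul]
        convert h1 using 1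
        rw [← mul_smul (algebraMap K _ _)]
        congr 1
        have h2 : ((l + 1 : ℕ) : UniversalEnvelopingAlgebra K 𝔤)
            = algebraMap K _ (l + 1 : K) := by simp
        rw [h2, mul_sub, ← map_mul, neg_mul, inv_mul_cancel₀ hl]
        simp only [map_sub, map_one, map_mul, aeval_C, aeval_X, map_neg]
        noncomm_ring
    obtain ⟨P, hP, hPv⟩ := key (n + 1)
    obtain ⟨Q, hQ, hQv⟩ := ih (mem_fil_pred hPv)
    exact ⟨Q * P, by simp [mul_coeff_zero, hP, hQ], by rwa [map_mul, mul_smul]⟩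

theorem exists_smul_mem_fil (u : UniversalEnvelopingAlgebra K 𝔤) {n : ℕ} (hv : v ∈ W.fil M n 0) :
    ∃ m : ℕ, u • v ∈ W.fil M m 0 := by
  have hu : u ∈ Algebra.adjoin K (Set.range (ι K : 𝔤 → UniversalEnvelopingAlgebra K 𝔤)) := by
    rw [InducedModule.adjoin_range_ι]; trivial
  have hadd : ∀ {v w : M}, (∃ m : ℕ, v ∈ W.fil M m 0) → (∃ m : ℕ, w ∈ W.fil M m 0) →
      ∃ m : ℕ, v + w ∈ W.fil M m 0 := by
    rintro v w ⟨m, hm⟩ ⟨m', hm'⟩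
    have h : v ∈ W.fil M (m + m' : ℕ) 0 := fil_mono (by omega) hm
    have h' : w ∈ W.fil M (m + m' : ℕ) 0 := fil_mono (by omega) hm'
    exact ⟨m + m', add_mem h h'⟩
  induction hu using Algebra.adjoin_induction generalizing n v with
  | algebraMap c => exact ⟨n, algebraMap_smul_mem c hv⟩
  | add x y _ _ hx hy => rw [add_smul]; exact hadd (hx hv) (hy hv)
  | mul x y _ _ hx hy =>
    obtain ⟨m, hm⟩ := hy hv
    rw [mul_smul]
    exact hx hm
  | mem x hx =>
    obtain ⟨a, rfl⟩ := hx
    have ha : a ∈ ⨆ i, W.Γ i := by rw [W.iSup_eq_top]; trivial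
    induction ha using Submodule.iSup_induction' with
    | zero => exact ⟨0, by simp⟩
    | add a b _ _ ha hb => rw [map_add, add_smul]; exact hadd ha hb
    | mem i a ha =>
      rw [W.ι_eq, add_smul]
      refine hadd ⟨(n + (2 - i)).toNat + 1, ?_⟩ ⟨n, algebraMap_smul_mem _ hv⟩
      have := ρ_smul_mem_fil (d := 2 - i) (by simpa using ha) hv
      exact fil_mono (by push_cast; omega) this

theorem mem_fil_zero_iff : v ∈ W.fil M 0 0 ↔ ∀ a ∈ W.𝔪, W.ρ a • v = 0 := by
  constructor
  · intro hv a ha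
    have h := W.𝔪_le ha
    refine Submodule.iSup_induction _ (motive := fun a => W.ρ a • v = 0) h (fun i b hb => ?_)
      (by simp) (fun b c hb hc => by rw [map_add, add_smul, hb, hc, add_zero])
    by_cases hi : 1 ≤ i
    · rw [iSup_pos hi] at hb
      exact eq_zero_of_mem_fil (by omega) (ρ_smul_mem ⟨hi, hb.1, hb.2⟩ hv)
    · rw [iSup_neg hi, Submodule.mem_bot] at hb
      rw [hb, map_zero, zero_smul]
  · intro h w hw hw'
    induction w using List.reverseRecOn with
    | nil => simp at hw'
    | append_singleton w b _ => simp [mul_smul, h b.2 (hw b (by simp)).2.1]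

variable (W) in
open Polynomial in
theorem exists_aeval_euler_mul_smul [CharZero K] (hv : ∀ a ∈ W.𝔪, W.ρ a • v = 0)
    (u : UniversalEnvelopingAlgebra K 𝔤) :
    ∃ P : K[X], P.coeff 0 = 1 ∧ ∀ a ∈ W.𝔪, W.ρ a • (aeval W.euler P * u) • v = 0 := by
  obtain ⟨n, hn⟩ := exists_smul_mem_fil u (n := 0) (mem_fil_zero_iff.2 hv)
  obtain ⟨P, hP, h⟩ := exists_aeval_euler_smul_mem hn
  refine ⟨P, hP, mem_fil_zero_iff.1 ?_⟩
  rwa [mul_smul]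

end WhittakerGrading

/-! ### Reduction by stages -/

namespace QuantumReduction

open Polynomial

variable {A : Type*} [Ring A] [Algebra ℂ A]

omit [Algebra ℂ A] in
theorem mul_mem_of_mem_span {S : Set A} {J : Ideal A} {X : A} (h : ∀ s ∈ S, s * X ∈ J) {a : A}
    (ha : a ∈ Ideal.span S) : a * X ∈ J := by
  induction ha using Submodule.span_induction with
  | mem s hs => exact h s hs
  | zero => rw [zero_mul]; exact zero_mem _
  | add a b _ _ ha hb => rw [add_mul]; exact add_mem ha hb
  | smul c a _ ha => rw [smul_eq_mul, mul_assoc]; exact J.mul_mem_left c ha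

theorem aeval_mul_sub_mem {J : Ideal A} {E X : A} (h : E * X ∈ J) {P : ℂ[X]}
    (hP : P.coeff 0 = 1) : aeval E P * X - X ∈ J := by
  have h1 : aeval E P * X - X = aeval E P.divX * (E * X) := by
    conv_lhs => rw [← P.divX_mul_X_add, hP]
    simp only [map_add, map_mul, aeval_X, map_one]
    noncomm_ring
  rw [h1]
  exact J.mul_mem_left _ h

variable {𝔪₁ 𝔪₂ 𝔪₀ : Type*} [LieRing 𝔪₁] [LieAlgebra ℂ 𝔪₁] [LieRing 𝔪₂] [LieAlgebra ℂ 𝔪₂]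
  [LieRing 𝔪₀] [LieAlgebra ℂ 𝔪₀]

/-- An element `E` of the left ideal is an Euler element if suitable polynomials in `E` map any
class to an invariant one. -/
def IsEuler (φ : 𝔪₁ →ₗ⁅ℂ⁆ A) (χ : 𝔪₁ →ₗ[ℂ] ℂ) (E : A) : Prop :=
  E ∈ leftIdeal φ χ ∧
    ∀ u : A, ∃ P : ℂ[X], P.coeff 0 = 1 ∧ toQ φ χ (aeval E P * u) ∈ invariants φ χ

theorem gen_mul_mem {φ : 𝔪₁ →ₗ⁅ℂ⁆ A} {χ : 𝔪₁ →ₗ[ℂ] ℂ} {X : A} (hX : toQ φ χ X ∈ invariants φ χ)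
    {a : A} (ha : a ∈ leftIdeal φ χ) : a * X ∈ leftIdeal φ χ := by
  refine mul_mem_of_mem_span ?_ ha
  rintro _ ⟨y, rfl⟩
  exact (lie_mem_iff y X).1 ((toQ_mem_invariants_iff X).1 hX y)

variable {φ₁ : 𝔪₁ →ₗ⁅ℂ⁆ A} {χ₁ : 𝔪₁ →ₗ[ℂ] ℂ} {φ₂ : 𝔪₂ →ₗ⁅ℂ⁆ A} {χ₂ : 𝔪₂ →ₗ[ℂ] ℂ}
  {j : 𝔪₀ →ₗ⁅ℂ⁆ invariants φ₁ χ₁} {χ₀ : 𝔪₀ →ₗ[ℂ] ℂ} {i₁ : 𝔪₁ → 𝔪₂} {i₀ : 𝔪₀ → 𝔪₂}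

variable (φ₁ χ₁ φ₂ χ₂ j χ₀ i₁ i₀) in
/-- The data of a reduction in two stages: `𝔪₂` is the sum of the images of `𝔪₁` and `𝔪₀`. -/
structure IsStages : Prop where
  φ₁_eq : ∀ y, φ₂ (i₁ y) = φ₁ y
  χ₁_eq : ∀ y, χ₂ (i₁ y) = χ₁ y
  j_eq : ∀ y, (j y : Q φ₁ χ₁) = toQ φ₁ χ₁ (φ₂ (i₀ y))
  χ₀_eq : ∀ y, χ₂ (i₀ y) = χ₀ y
  exists_add : ∀ y, ∃ y₁ y₀, y = i₁ y₁ + i₀ y₀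

namespace IsStages

variable (h : IsStages φ₁ χ₁ φ₂ χ₂ j χ₀ i₁ i₀)

include h

theorem leftIdeal_le : leftIdeal φ₁ χ₁ ≤ leftIdeal φ₂ χ₂ := by
  refine Submodule.span_le.2 ?_
  rintro _ ⟨y, rfl⟩
  change φ₁ y - algebraMap ℂ A (χ₁ y) ∈ leftIdeal φ₂ χ₂
  rw [← h.φ₁_eq, ← h.χ₁_eq]
  exact gen_mem _

theorem mem_invariants (y : 𝔪₀) : toQ φ₁ χ₁ (φ₂ (i₀ y)) ∈ invariants φ₁ χ₁ :=
  h.j_eq y ▸ (j y).2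

theorem j_eq' (y : 𝔪₀) : j y = ⟨toQ φ₁ χ₁ (φ₂ (i₀ y)), h.mem_invariants y⟩ :=
  Subtype.ext (h.j_eq y)

theorem gen_mem_invariants (y : 𝔪₀) :
    toQ φ₁ χ₁ (φ₂ (i₀ y) - algebraMap ℂ A (χ₂ (i₀ y))) ∈ invariants φ₁ χ₁ := by
  have h1 := sub_mem (h.mem_invariants y)
    (Submodule.smul_mem _ (χ₂ (i₀ y)) (1 : invariants φ₁ χ₁).2)
  rw [Algebra.algebraMap_eq_smul_one]
  exact h1

theorem j_sub_eq (y : 𝔪₀) : j y - algebraMap ℂ (invariants φ₁ χ₁) (χ₀ y)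
    = ⟨toQ φ₁ χ₁ (φ₂ (i₀ y) - algebraMap ℂ A (χ₂ (i₀ y))), h.gen_mem_invariants y⟩ := by
  rw [h.j_eq', Algebra.algebraMap_eq_smul_one, ← h.χ₀_eq]
  exact Subtype.ext (congrArg (fun s => toQ φ₁ χ₁ (φ₂ (i₀ y) - s))
    (Algebra.algebraMap_eq_smul_one (χ₂ (i₀ y))).symm)

theorem lie_j_eq (y : 𝔪₀) {X : A} (hX : toQ φ₁ χ₁ X ∈ invariants φ₁ χ₁) :
    ((⁅j y, (⟨toQ φ₁ χ₁ X, hX⟩ : invariants φ₁ χ₁)⁆ : invariants φ₁ χ₁) : Q φ₁ χ₁)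
      = toQ φ₁ χ₁ ⁅φ₂ (i₀ y), X⁆ := by
  rw [h.j_eq', LieRing.of_associative_ring_bracket, LieRing.of_associative_ring_bracket]
  rfl

/-- Classes in the second left ideal vanish modulo the second stage. -/
theorem mem_of_mem_leftIdeal {a : invariants φ₁ χ₁} (ha : a ∈ leftIdeal j χ₀) {X : A}
    (hX : (a : Q φ₁ χ₁) = toQ φ₁ χ₁ X) : X ∈ leftIdeal φ₂ χ₂ := by
  have key : ∀ a ∈ leftIdeal j χ₀,
      Submodule.mapQ _ (leftIdeal φ₂ χ₂) LinearMap.id h.leftIdeal_le (a : Q φ₁ χ₁) = 0 := by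
    intro a ha
    induction ha using Submodule.closure_induction with
    | zero => simp
    | add a b _ _ ha hb => rw [Submodule.coe_add, map_add, ha, hb, add_zero]
    | smul_mem b a ha =>
      obtain ⟨y, rfl⟩ := ha
      obtain ⟨Y, hY, rfl⟩ := exists_rep b
      beta_reduce
      rw [h.j_sub_eq, smul_eq_mul, mk_mul_mk]
      exact (Submodule.Quotient.mk_eq_zero _).2 (Ideal.mul_mem_left _ _ (gen_mem _))
  have h1 := key a ha
  rw [hX] at h1
  exact (Submodule.Quotient.mk_eq_zero _).1 h1

variable {E : A} (hE : IsEuler φ₁ χ₁ E)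

include hE

theorem exists_aeval_mul {X : A} (hX : X ∈ leftIdeal φ₂ χ₂) :
    ∃ P : ℂ[X], P.coeff 0 = 1 ∧ ∃ a ∈ leftIdeal j χ₀, (a : Q φ₁ χ₁) = toQ φ₁ χ₁ (aeval E P * X) := by
  have fix : ∀ {X : A} {P R : ℂ[X]} {a : invariants φ₁ χ₁}, R.coeff 0 = 1 →
      (a : Q φ₁ χ₁) = toQ φ₁ χ₁ (aeval E P * X) →
      (a : Q φ₁ χ₁) = toQ φ₁ χ₁ (aeval E (R * P) * X) := by
    intro X P R a hR ha
    have h1 : toQ φ₁ χ₁ (aeval E P * X) ∈ invariants φ₁ χ₁ := ha ▸ a.2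
    rw [ha, map_mul, mul_assoc]
    exact ((Submodule.Quotient.eq _).2 (aeval_mul_sub_mem (gen_mul_mem h1 hE.1) hR)).symm
  induction hX using Submodule.closure_induction with
  | zero => exact ⟨1, by simp, 0, zero_mem _, by simp⟩
  | add X Y _ _ hX hY =>
    obtain ⟨P, hP, a, ha, haX⟩ := hX
    obtain ⟨R, hR, b, hb, hbY⟩ := hY
    refine ⟨R * P, by simp [mul_coeff_zero, hP, hR], a + b, add_mem ha hb, ?_⟩
    rw [Submodule.coe_add, fix hR haX, fix hP hbY, mul_comm P R, mul_add]
    rfl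
  | smul_mem u X hX =>
    obtain ⟨y, rfl⟩ := hX
    obtain ⟨y₁, y₀, rfl⟩ := h.exists_add y
    obtain ⟨P, hP, hu⟩ := hE.2 u
    refine ⟨P, hP, ⟨_, hu⟩ * (j y₀ - algebraMap ℂ _ (χ₀ y₀)),
      Ideal.mul_mem_left _ _ (gen_mem y₀), ?_⟩
    rw [h.j_sub_eq, mk_mul_mk]
    refine ((Submodule.Quotient.eq _).2 ?_).symm
    have h1 : aeval E P * u • (φ₂ (i₁ y₁ + i₀ y₀) - algebraMap ℂ A (χ₂ (i₁ y₁ + i₀ y₀)))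
        - aeval E P * u * (φ₂ (i₀ y₀) - algebraMap ℂ A (χ₂ (i₀ y₀)))
        = aeval E P * u * (φ₁ y₁ - algebraMap ℂ A (χ₁ y₁)) := by
      rw [← h.φ₁_eq, ← h.χ₁_eq, smul_eq_mul]
      simp only [map_add]
      noncomm_ring
    rw [h1]
    exact Ideal.mul_mem_left _ _ (gen_mem _)

/-- An invariant class that vanishes modulo the second left ideal is in the ideal of the second
stage. -/
theorem mem_leftIdeal_iff {X : A} (hX : toQ φ₁ χ₁ X ∈ invariants φ₁ χ₁) :
    (⟨toQ φ₁ χ₁ X, hX⟩ : invariants φ₁ χ₁) ∈ leftIdeal j χ₀ ↔ X ∈ leftIdeal φ₂ χ₂ := by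
  refine ⟨fun h1 => h.mem_of_mem_leftIdeal h1 rfl, fun h1 => ?_⟩
  obtain ⟨P, hP, a, ha, haX⟩ := h.exists_aeval_mul hE h1
  convert ha
  rw [haX]
  exact ((Submodule.Quotient.eq _).2 (aeval_mul_sub_mem (gen_mul_mem hX hE.1) hP)).symm

theorem toQ_mem_invariants_iff {X : A} (hX : toQ φ₁ χ₁ X ∈ invariants φ₁ χ₁) :
    toQ j χ₀ ⟨toQ φ₁ χ₁ X, hX⟩ ∈ invariants j χ₀ ↔ toQ φ₂ χ₂ X ∈ invariants φ₂ χ₂ := by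
  rw [QuantumReduction.toQ_mem_invariants_iff, QuantumReduction.toQ_mem_invariants_iff]
  have h1 : ∀ y : 𝔪₀, ⁅j y, (⟨toQ φ₁ χ₁ X, hX⟩ : invariants φ₁ χ₁)⁆ ∈ leftIdeal j χ₀ ↔
      ⁅φ₂ (i₀ y), X⁆ ∈ leftIdeal φ₂ χ₂ := by
    intro y
    have h2 := h.lie_j_eq y hX
    have h3 : toQ φ₁ χ₁ ⁅φ₂ (i₀ y), X⁆ ∈ invariants φ₁ χ₁ := h2 ▸ Subtype.property _
    rw [← h.mem_leftIdeal_iff hE h3]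
    exact iff_of_eq (congrArg (· ∈ leftIdeal j χ₀) (Subtype.ext h2))
  simp only [h1]
  refine ⟨fun h2 y => ?_, fun h2 y => h2 _⟩
  obtain ⟨y₁, y₀, rfl⟩ := h.exists_add y
  rw [map_add, add_lie]
  refine add_mem ?_ (h2 y₀)
  rw [h.φ₁_eq]
  exact h.leftIdeal_le ((QuantumReduction.toQ_mem_invariants_iff X).1 hX y₁)

theorem exists_lift {X : A} (hX : toQ φ₂ χ₂ X ∈ invariants φ₂ χ₂) :
    ∃ Y : A, toQ φ₁ χ₁ Y ∈ invariants φ₁ χ₁ ∧ toQ φ₂ χ₂ Y = toQ φ₂ χ₂ X := by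
  obtain ⟨P, hP, hPX⟩ := hE.2 X
  exact ⟨_, hPX, (Submodule.Quotient.eq _).2
    (aeval_mul_sub_mem (gen_mul_mem hX (h.leftIdeal_le hE.1)) hP)⟩

/-- Reduction by stages. -/
theorem exists_algEquiv : ∃ Ψ : invariants j χ₀ ≃ₐ[ℂ] invariants φ₂ χ₂,
    ∀ (X : A) (hX : toQ φ₁ χ₁ X ∈ invariants φ₁ χ₁)
      (hX₀ : toQ j χ₀ ⟨toQ φ₁ χ₁ X, hX⟩ ∈ invariants j χ₀),
      (Ψ ⟨toQ j χ₀ ⟨toQ φ₁ χ₁ X, hX⟩, hX₀⟩ : Q φ₂ χ₂) = toQ φ₂ χ₂ X := by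
  let θ : invariants φ₁ χ₁ →+ Q φ₂ χ₂ :=
    (Submodule.mapQ (leftIdeal φ₁ χ₁) (leftIdeal φ₂ χ₂) LinearMap.id
      h.leftIdeal_le).toAddMonoidHom.comp (invariants φ₁ χ₁).subtype.toAddMonoidHom
  let Θ : Q j χ₀ →+ Q φ₂ χ₂ := QuotientAddGroup.lift (leftIdeal j χ₀).toAddSubgroup θ (by
    intro a ha
    obtain ⟨X, hX, rfl⟩ := exists_rep a
    exact (Submodule.Quotient.mk_eq_zero _).2 ((h.mem_leftIdeal_iff hE hX).1 ha))
  have hrep : ∀ a : invariants j χ₀, ∃ (X : A) (hX : toQ φ₁ χ₁ X ∈ invariants φ₁ χ₁)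
      (hX₀ : toQ j χ₀ ⟨toQ φ₁ χ₁ X, hX⟩ ∈ invariants j χ₀), a = ⟨_, hX₀⟩ := by
    intro a
    obtain ⟨b, hb, rfl⟩ := exists_rep a
    obtain ⟨X, hX, rfl⟩ := exists_rep b
    exact ⟨X, hX, hb, rfl⟩
  have hmem : ∀ a : invariants j χ₀, Θ a ∈ invariants φ₂ χ₂ := by
    intro a
    obtain ⟨X, hX, hX₀, rfl⟩ := hrep a
    exact (h.toQ_mem_invariants_iff hE hX).1 hX₀
  let Ψ : invariants j χ₀ →ₗ[ℂ] invariants φ₂ χ₂ :=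
    { toFun := fun a => ⟨Θ a, hmem a⟩
      map_add' := fun a b => Subtype.ext (map_add Θ (a : Q j χ₀) b)
      map_smul' := fun c a => by
        obtain ⟨X, hX, hX₀, rfl⟩ := hrep a
        rfl }
  let Ψ' : invariants j χ₀ →ₐ[ℂ] invariants φ₂ χ₂ := AlgHom.ofLinearMap Ψ rfl (by
    intro a b
    obtain ⟨X, hX, hX₀, rfl⟩ := hrep a
    obtain ⟨Y, hY, hY₀, rfl⟩ := hrep b
    rfl)
  refine ⟨AlgEquiv.ofBijective Ψ' ⟨?_, ?_⟩, fun X hX hX₀ => rfl⟩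
  · refine (injective_iff_map_eq_zero Ψ').2 fun a ha => ?_
    obtain ⟨X, hX, hX₀, rfl⟩ := hrep a
    have h1 : toQ φ₂ χ₂ X = 0 := congrArg Subtype.val ha
    exact Subtype.ext ((Submodule.Quotient.mk_eq_zero _).2
      ((h.mem_leftIdeal_iff hE hX).2 ((Submodule.Quotient.mk_eq_zero _).1 h1)))
  · intro b
    obtain ⟨X, hX, rfl⟩ := exists_rep b
    obtain ⟨Y, hY, hYX⟩ := h.exists_lift hE hX
    refine ⟨⟨toQ j χ₀ ⟨_, hY⟩, (h.toQ_mem_invariants_iff hE hY).2 (hYX ▸ hX)⟩, Subtype.ext ?_⟩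
    exact hYX

end IsStages

end QuantumReduction

namespace FiniteW

variable {𝔤 : Type*} [LieRing 𝔤] [LieAlgebra ℂ 𝔤] {B : LinearMap.BilinForm ℂ 𝔤}
  {Γ : ℤ → Submodule ℂ 𝔤} {f q : 𝔤} {𝔪 : LieSubalgebra ℂ 𝔤}

/-- Components of a grading given by an element of `𝔤` are orthogonal unless their degrees are
opposite. -/
theorem form_eq_zero (hB : B.lieInvariant 𝔤) (hq : IsGradingElement Γ q) {i j : ℤ} {a b : 𝔤}
    (ha : a ∈ Γ i) (hb : b ∈ Γ j) (hij : i + j ≠ 0) : B a b = 0 := by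
  have h := hB q a b
  rw [(hq i a).1 ha, (hq j b).1 hb] at h
  simp only [map_smul, LinearMap.smul_apply, smul_eq_mul] at h
  have h1 : ((i + j : ℤ) : ℂ) * B a b = 0 := by push_cast; linear_combination h
  exact (mul_eq_zero.1 h1).resolve_left (by exact_mod_cast hij)

theorem chi_eq_zero (hB : B.lieInvariant 𝔤) (hq : IsGradingElement Γ q) (hf : f ∈ Γ (-2)) {i : ℤ}
    {a : 𝔤} (ha : a ∈ Γ i) (hi : i ≠ 2) : chi B f a = 0 :=
  form_eq_zero hB hq hf ha (by omega)

namespace IsGoodAlgebra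

variable (h𝔪 : IsGoodAlgebra B Γ f 𝔪)

include h𝔪

theorem mem_of_mem {i : ℤ} {a : 𝔤} (hi : 2 ≤ i) (ha : a ∈ Γ i) : a ∈ 𝔪 := by
  obtain ⟨𝔩, -, h⟩ := h𝔪
  have h1 : Γ i ≤ 𝔪.toSubmodule := h ▸ le_sup_of_le_right (le_iSup₂_of_le i hi le_rfl)
  exact h1 ha

theorem le_iSup : 𝔪.toSubmodule ≤ ⨆ (i : ℤ) (_ : 1 ≤ i), 𝔪.toSubmodule ⊓ Γ i := by
  obtain ⟨𝔩, h𝔩, h⟩ := h𝔪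
  conv_lhs => rw [h]
  refine sup_le ?_ (iSup₂_le fun i hi => ?_)
  · refine le_iSup₂_of_le 1 le_rfl (le_inf ?_ fun a ha => ((h𝔩 a).1 ha).1)
    rw [h]
    exact le_sup_left
  · refine le_iSup₂_of_le i (by omega) (le_inf ?_ le_rfl)
    rw [h]
    exact le_sup_of_le_right (le_iSup₂_of_le i hi le_rfl)

/-- The form `χ` is a character of a good algebra. -/
theorem chi_lie (hB : B.lieInvariant 𝔤) (hΓ : IsGoodGrading Γ f) (hq : IsGradingElement Γ q)
    {a b : 𝔤} (ha : a ∈ 𝔪) (hb : b ∈ 𝔪) : chi B f ⁅a, b⁆ = 0 := by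
  have hle := h𝔪.le_iSup
  obtain ⟨𝔩, h𝔩, h⟩ := h𝔪
  have hskew : ∀ a b : 𝔤, chi B f ⁅a, b⁆ = 0 ↔ chi B f ⁅b, a⁆ = 0 := fun a b => by
    rw [← lie_skew, map_neg, neg_eq_zero]
  have key : ∀ a ∈ (⨆ (i : ℤ) (_ : 2 ≤ i), Γ i), ∀ b ∈ 𝔪, chi B f ⁅b, a⁆ = 0 := by
    intro a ha b hb
    refine (iSup₂_le (a := LinearMap.ker ((chi B f).comp (LieAlgebra.ad ℂ 𝔤 b))) ?_) ha
    intro i hi a ha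
    change chi B f ⁅b, a⁆ = 0
    rw [hskew]
    refine (iSup₂_le (a := LinearMap.ker ((chi B f).comp (LieAlgebra.ad ℂ 𝔤 a))) ?_) (hle hb)
    intro j hj b hb
    exact chi_eq_zero hB hq hΓ.mem_neg_two (hΓ.lie_mem i j a ha b hb.2) (by omega)
  have ha' : a ∈ 𝔩 ⊔ ⨆ (i : ℤ) (_ : 2 ≤ i), Γ i := h ▸ ha
  have hb' : b ∈ 𝔩 ⊔ ⨆ (i : ℤ) (_ : 2 ≤ i), Γ i := h ▸ hb
  have hl𝔪 : 𝔩 ≤ 𝔪.toSubmodule := h ▸ le_sup_left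
  obtain ⟨l, hl, r, hr, rfl⟩ := Submodule.mem_sup.1 ha'
  obtain ⟨l', hl', r', hr', rfl⟩ := Submodule.mem_sup.1 hb'
  rw [add_lie, map_add, (hskew r _).2 (key r hr _ hb), lie_add, map_add,
    ((h𝔩 l).1 hl).2 l' hl', key r' hr' l (hl𝔪 hl)]
  simp

variable [FiniteDimensional ℂ 𝔤]

omit h𝔪 in
/-- In a fixed degree, a graded subalgebra has a basis with a dual family for the pairing
`χ ⁅·, ·⁆`. -/
theorem exists_dual (hB : B.lieInvariant 𝔤) (hBn : B.Nondegenerate) (hΓ : IsGoodGrading Γ f)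
    (hq : IsGradingElement Γ q) {i : ℤ} (hi : 1 ≤ i) :
    ∃ z x : Fin (Module.finrank ℂ ↥(𝔪.toSubmodule ⊓ Γ i)) → 𝔤,
      (∀ k, z k ∈ 𝔪 ∧ z k ∈ Γ i) ∧ (∀ k, x k ∈ Γ (2 - i)) ∧
      ∀ a ∈ 𝔪, a ∈ Γ i → ∑ k, chi B f ⁅a, x k⁆ • z k = a := by
  let N := 𝔪.toSubmodule ⊓ Γ i
  let b := Module.finBasis ℂ N
  let T : N →ₗ[ℂ] Γ (2 - i) →ₗ[ℂ] ℂ :=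
    LinearMap.mk₂ ℂ (fun a x => chi B f ⁅(a : 𝔤), (x : 𝔤)⁆) (by intros; simp) (by intros; simp)
      (by intros; simp) (by intros; simp)
  have hT : Function.Injective T := by
    refine (injective_iff_map_eq_zero T).2 fun a ha => Subtype.ext ?_
    refine hΓ.injective i hi a a.2.2 (hBn.1 _ fun y => ?_)
    have hy : y ∈ ⨆ j, Γ j := by rw [hΓ.isInternal.submodule_iSup_eq_top]; trivial
    refine (iSup_le (a := LinearMap.ker (B ⁅f, (a : 𝔤)⁆)) ?_) hy
    intro j y hy
    rw [LinearMap.mem_ker]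
    by_cases hj : j = 2 - i
    · subst hj
      have h1 : B f ⁅(a : 𝔤), y⁆ = 0 := LinearMap.congr_fun ha ⟨y, hy⟩
      have h2 := hB (a : 𝔤) f y
      rw [← lie_skew, map_neg, LinearMap.neg_apply, h2, h1, neg_zero, neg_zero]
    · exact form_eq_zero hB hq (hΓ.lie_mem _ _ f hΓ.mem_neg_two _ a.2.2) hy (by omega)
  choose x hx using fun k => LinearMap.flip_surjective_iff₁.2 hT (b.coord k)
  refine ⟨fun k => b k, fun k => x k, fun k => (b k).2, fun k => (x k).2, fun a ha ha' => ?_⟩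
  have h1 : ∀ k, chi B f ⁅a, (x k : 𝔤)⁆ = b.repr ⟨a, ha, ha'⟩ k := fun k =>
    LinearMap.congr_fun (hx k) ⟨a, ha, ha'⟩
  simp only [h1]
  have h2 := congrArg N.subtype (b.sum_repr ⟨a, ha, ha'⟩)
  simpa only [map_sum, map_smul, Submodule.subtype_apply] using h2

/-- The left ideal defining a finite W-algebra contains an Euler element. -/
theorem exists_isEuler (hB : B.lieInvariant 𝔤) (hBn : B.Nondegenerate) (hΓ : IsGoodGrading Γ f)
    (hq : IsGradingElement Γ q) : ∃ E, QuantumReduction.IsEuler (toU 𝔪) (chiOn B f 𝔪) E := by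
  have hfin : {i | Γ i ≠ ⊥}.Finite :=
    WellFoundedGT.finite_ne_bot_of_iSupIndep hΓ.isInternal.submodule_iSupIndep
  let S : Finset ℤ := hfin.toFinset.filter (1 ≤ ·)
  have hS : ∀ i : S, 1 ≤ (i : ℤ) := fun i => (Finset.mem_filter.1 i.2).2
  choose z x hz hx hd using fun i : S => exists_dual (𝔪 := 𝔪) hB hBn hΓ hq (hS i)
  let W : WhittakerGrading ℂ 𝔤 ((i : S) × Fin (Module.finrank ℂ ↥(𝔪.toSubmodule ⊓ Γ i))) :=
    { Γ := Γ
      χ := chi B f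
      𝔪 := 𝔪
      deg := fun k => k.1
      z := fun k => z k.1 k.2
      x := fun k => x k.1 k.2
      iSup_eq_top := hΓ.isInternal.submodule_iSup_eq_top
      lie_mem := fun ha hb => hΓ.lie_mem _ _ _ ha _ hb
      χ_eq_zero := fun ha hi => chi_eq_zero hB hq hΓ.mem_neg_two ha hi
      χ_lie := fun ha hb => h𝔪.chi_lie hB hΓ hq ha hb
      le_𝔪 := fun hi ha => h𝔪.mem_of_mem hi ha
      𝔪_le := h𝔪.le_iSup
      one_le_deg := fun k => hS k.1
      z_mem := fun k => (hz k.1 k.2).1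
      z_mem_Γ := fun k => (hz k.1 k.2).2
      x_mem_Γ := fun k => hx k.1 k.2
      dual := by
        intro i a hi ha ha'
        rw [Fintype.sum_sigma]
        by_cases h0 : Γ i = ⊥
        · rw [h0, Submodule.mem_bot] at ha'
          subst ha'
          simp
        · have hiS : i ∈ S := Finset.mem_filter.2 ⟨hfin.mem_toFinset.2 h0, hi⟩
          rw [Finset.sum_eq_single (⟨i, hiS⟩ : S)]
          · exact hd ⟨i, hiS⟩ a ha ha'
          · intro j _ hj
            refine Finset.sum_eq_zero fun k _ => ?_
            have hne : (j : ℤ) ≠ i := fun h => hj (Subtype.ext h)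
            rw [chi_eq_zero hB hq hΓ.mem_neg_two (hΓ.lie_mem _ _ _ ha' _ (hx j k)) (by omega),
              zero_smul]
          · simp }
  refine ⟨W.euler, sum_mem fun k _ => Ideal.mul_mem_left _ _ ?_, fun u => ?_⟩
  · exact QuantumReduction.gen_mem (φ := toU 𝔪) (χ := chiOn B f 𝔪) ⟨W.z k, W.z_mem k⟩
  · have hv : ∀ a ∈ W.𝔪, W.ρ a • toGG B f 𝔪 1 = 0 := by
      intro a ha
      refine (Submodule.Quotient.mk_eq_zero _).2 ?_
      beta_reduce
      rw [smul_eq_mul, mul_one]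
      exact QuantumReduction.gen_mem (φ := toU 𝔪) (χ := chiOn B f 𝔪) ⟨a, ha⟩
    obtain ⟨P, hP, h⟩ := W.exists_aeval_euler_mul_smul hv u
    refine ⟨P, hP, (QuantumReduction.toQ_mem_invariants_iff _).2 fun y => ?_⟩
    rw [QuantumReduction.lie_mem_iff]
    have h1 := (Submodule.Quotient.mk_eq_zero _).1 (h y y.2)
    beta_reduce at h1
    rw [smul_eq_mul, smul_eq_mul, mul_one] at h1
    exact h1

end IsGoodAlgebra

end FiniteW

theorem theorem3p6 {𝔤 : Type*} [LieRing 𝔤] [LieAlgebra ℂ 𝔤] [FiniteDimensional ℂ 𝔤]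
    [LieAlgebra.IsSimple ℂ 𝔤]
    (B : LinearMap.BilinForm ℂ 𝔤) (hB_symm : B.IsSymm) (hB_nondeg : B.Nondegenerate)
    (hB_inv : B.lieInvariant 𝔤)
    (f₁ f₂ : 𝔤) (hf₁ : IsNilpotent (LieAlgebra.ad ℂ 𝔤 f₁))
    (hf₂ : IsNilpotent (LieAlgebra.ad ℂ 𝔤 f₂))
    (Γ₁ Γ₂ : ℤ → Submodule ℂ 𝔤)
    (hΓ₁ : FiniteW.IsGoodGrading Γ₁ f₁) (hΓ₂ : FiniteW.IsGoodGrading Γ₂ f₂)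
    (q₁ q₂ : 𝔤) (hq₁ : FiniteW.IsGradingElement Γ₁ q₁) (hq₂ : FiniteW.IsGradingElement Γ₂ q₂)
    (𝔥 : LieSubalgebra ℂ 𝔤) (h𝔥 : 𝔥.IsCartanSubalgebra) (hq₁𝔥 : q₁ ∈ 𝔥) (hq₂𝔥 : q₂ ∈ 𝔥)
    (𝔪₁ 𝔪₂ 𝔪₀ : LieSubalgebra ℂ 𝔤)
    (h𝔪₁ : FiniteW.IsGoodAlgebra B Γ₁ f₁ 𝔪₁) (h𝔪₂ : FiniteW.IsGoodAlgebra B Γ₂ f₂ 𝔪₂)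
    -- `𝔪₂ = 𝔪₁ ⊕ 𝔪₀`, with `𝔪₀` stable under `𝔥` and `𝔪₁` an ideal of `𝔪₂`
    (h_sup : 𝔪₂.toSubmodule = 𝔪₁.toSubmodule ⊔ 𝔪₀.toSubmodule)
    (h_disj : Disjoint 𝔪₁.toSubmodule 𝔪₀.toSubmodule)
    (h𝔪₀ : ∀ x ∈ 𝔥, ∀ y ∈ 𝔪₀, ⁅x, y⁆ ∈ 𝔪₀)
    (h_ideal : ∀ x ∈ 𝔪₂, ∀ y ∈ 𝔪₁, ⁅x, y⁆ ∈ 𝔪₁)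
    (hf₀ : f₂ - f₁ ∈ Γ₁ 0) (h𝔪₀Γ : ∀ y ∈ 𝔪₀, y ∈ Γ₁ 0)
    (hq₀ : ⁅q₂ - q₁, f₁⁆ = 0) :
    -- `y ↦ y mod Î₁` is an embedding `j` of Lie algebras of `𝔪₀` into `U(𝔤, f₁)`
    ∃ j : 𝔪₀ →ₗ⁅ℂ⁆ FiniteW.WAlgebra B f₁ 𝔪₁,
      (∀ y : 𝔪₀, (j y : FiniteW.GelfandGraev B f₁ 𝔪₁)
        = FiniteW.toGG B f₁ 𝔪₁ (UniversalEnvelopingAlgebra.ι ℂ (y : 𝔤))) ∧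
      Function.Injective j ∧
      -- `(U(𝔤, f₁) / Î₀)^{ad 𝔪₀} → U(𝔤, f₂)`, `(X mod Î₁) mod Î₀ ↦ X mod Î₂`
      ∃ Ψ : QuantumReduction.invariants j (FiniteW.chiOn B f₂ 𝔪₀)
          ≃ₐ[ℂ] FiniteW.WAlgebra B f₂ 𝔪₂,
        ∀ (X : UniversalEnvelopingAlgebra ℂ 𝔤)
          (hX : FiniteW.toGG B f₁ 𝔪₁ X ∈ FiniteW.WAlgebra B f₁ 𝔪₁)
          (hX₀ : QuantumReduction.toQ j (FiniteW.chiOn B f₂ 𝔪₀) ⟨FiniteW.toGG B f₁ 𝔪₁ X, hX⟩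
            ∈ QuantumReduction.invariants j (FiniteW.chiOn B f₂ 𝔪₀)),
          (Ψ ⟨QuantumReduction.toQ j (FiniteW.chiOn B f₂ 𝔪₀)
              ⟨FiniteW.toGG B f₁ 𝔪₁ X, hX⟩, hX₀⟩ : FiniteW.GelfandGraev B f₂ 𝔪₂)
            = FiniteW.toGG B f₂ 𝔪₂ X := by
  have hχ : ∀ y ∈ 𝔪₁, FiniteW.chi B f₂ y = FiniteW.chi B f₁ y := by
    intro y hy
    rw [← sub_eq_zero, ← LinearMap.sub_apply, ← map_sub]
    refine (iSup₂_le (a := LinearMap.ker (B (f₂ - f₁))) ?_) (h𝔪₁.le_iSup hy)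
    exact fun i hi a ha => FiniteW.form_eq_zero hB_inv hq₁ hf₀ ha.2 (by omega)
  have hle₁ : ∀ y ∈ 𝔪₁, y ∈ 𝔪₂ := fun y hy =>
    (h_sup ▸ le_sup_left : 𝔪₁.toSubmodule ≤ 𝔪₂.toSubmodule) hy
  have hle₀ : ∀ y ∈ 𝔪₀, y ∈ 𝔪₂ := fun y hy =>
    (h_sup ▸ le_sup_right : 𝔪₀.toSubmodule ≤ 𝔪₂.toSubmodule) hy
  have hmem : ∀ y : 𝔪₀, FiniteW.toGG B f₁ 𝔪₁ (UniversalEnvelopingAlgebra.ι ℂ (y : 𝔤))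
      ∈ FiniteW.WAlgebra B f₁ 𝔪₁ := by
    intro y
    refine (QuantumReduction.toQ_mem_invariants_iff _).2 fun z => ?_
    have h1 : ⁅(z : 𝔤), (y : 𝔤)⁆ ∈ 𝔪₁ := by
      rw [← lie_skew]
      exact neg_mem (h_ideal y (hle₀ y y.2) z z.2)
    have h2 := QuantumReduction.gen_mem (φ := FiniteW.toU 𝔪₁) (χ := FiniteW.chiOn B f₁ 𝔪₁) ⟨_, h1⟩
    have h3 : FiniteW.chiOn B f₁ 𝔪₁ ⟨_, h1⟩ = 0 :=
      (hχ _ h1).symm.trans (h𝔪₂.chi_lie hB_inv hΓ₂ hq₂ (hle₁ z z.2) (hle₀ y y.2))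
    rw [h3, map_zero, sub_zero] at h2
    convert h2 using 1
    exact (LieHom.map_lie (UniversalEnvelopingAlgebra.ι ℂ) (z : 𝔤) (y : 𝔤)).symm
  let j : 𝔪₀ →ₗ⁅ℂ⁆ FiniteW.WAlgebra B f₁ 𝔪₁ :=
    { toFun := fun y => ⟨_, hmem y⟩
      map_add' := fun x y => Subtype.ext (congrArg (FiniteW.toGG B f₁ 𝔪₁)
        (map_add (UniversalEnvelopingAlgebra.ι ℂ) (x : 𝔤) y))
      map_smul' := fun c x => Subtype.ext (congrArg (FiniteW.toGG B f₁ 𝔪₁)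
        (map_smul (UniversalEnvelopingAlgebra.ι ℂ) c (x : 𝔤)))
      map_lie' := fun {x y} => Subtype.ext (congrArg (FiniteW.toGG B f₁ 𝔪₁)
        (LieHom.map_lie (UniversalEnvelopingAlgebra.ι ℂ) (x : 𝔤) y)) }
  have h𝔤 : ∀ x : 𝔤, (∀ y : 𝔤, ⁅x, y⁆ = 0) → x = 0 := by
    intro x hx
    have h1 : x ∈ LieAlgebra.center ℂ 𝔤 := by
      rw [LieModule.mem_maxTrivSubmodule]
      intro y
      rw [← lie_skew, hx, neg_zero]
    rwa [LieAlgebra.center_eq_bot, LieSubmodule.mem_bot] at h1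
  refine ⟨j, fun y => rfl, (injective_iff_map_eq_zero j).2 fun y hy => ?_, ?_⟩
  · have h1 := (Submodule.Quotient.mk_eq_zero _).1 (congrArg Subtype.val hy)
    have h2 : (y : 𝔤) ∈ 𝔪₁ := InducedModule.mem_of_ι_mem_span h𝔤 𝔪₁ (FiniteW.chiOn B f₁ 𝔪₁)
      (fun a b => h𝔪₁.chi_lie hB_inv hΓ₁ hq₁ a.2 b.2) h1
    exact Subtype.ext (Submodule.disjoint_def.1 h_disj _ h2 y.2)
  · obtain ⟨E, hE⟩ := h𝔪₁.exists_isEuler hB_inv hB_nondeg hΓ₁ hq₁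
    have hst : QuantumReduction.IsStages (FiniteW.toU 𝔪₁) (FiniteW.chiOn B f₁ 𝔪₁)
        (FiniteW.toU 𝔪₂) (FiniteW.chiOn B f₂ 𝔪₂) j (FiniteW.chiOn B f₂ 𝔪₀)
        (fun y => ⟨y, hle₁ y y.2⟩) (fun y => ⟨y, hle₀ y y.2⟩) :=
      { φ₁_eq := fun y => rfl
        χ₁_eq := fun y => hχ y y.2
        j_eq := fun y => rfl
        χ₀_eq := fun y => rfl
        exists_add := fun y => by
          have hy : (y : 𝔤) ∈ 𝔪₁.toSubmodule ⊔ 𝔪₀.toSubmodule := h_sup ▸ y.2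
          obtain ⟨y₁, h₁, y₀, h₀, h⟩ := Submodule.mem_sup.1 hy
          exact ⟨⟨y₁, h₁⟩, ⟨y₀, h₀⟩, Subtype.ext h.symm⟩ }
    exact hst.exists_algEquiv hE
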